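/- Let $\mathrm{Diff}(\mathbb{C},0)$ be the group, under composition, of germs of analytic diffeomorphisms of $\mathbb{C}$ fixing $0$, let $r>0$, and let $\Delta$ be the disc of radius $r$ around $0$. Write $\mathrm{Aut}(\Delta)$ for the set of germs, at points of $\Delta$, of invertible holomorphic maps with values in $\Delta$. The D-groupoids on $\Delta$ are given by one of the following equations for $y=y(x)$, where $y_i=d^iy/dx^i$: - $G_0(h)$: $h(x)-h(y)=0$, with $h$ holomorphic on $\Delta$; - $G_1^n(\eta)$: $\eta(y)\,y_1^n-\eta(x)=0$, with $n\in\mathbb{Z}$ and $\eta$ meromorphic on $\Delta$; - $G_2(\mu)$: $\mu(y)\,y_1+\frac{y_2}{y_1}-\mu(x)=0$, with $\mu$ meromorphic on $\Delta$; - $G_3(\nu)$: $\nu(y)\,y_1^2+2\frac{y_3}{y_1}-3\left(\frac{y_2}{y_1}\right)^2-\nu(x)=0$, with $\nu$ meromorphic on $\Delta$; - $G_\infty$: $0=0$. The solutions of a D-groupoid are the germs in $\mathrm{Aut}(\Delta)$ that satisfy its equation on a punctured neighbourhood of their base point. The Galois closure of a subgroup $G$ of $\mathrm{Diff}(\mathbb{C},0)$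 is the smallest D-groupoid in this list that has all elements of $G$ among its solutions; its solutions are the common solutions of all the D-groupoids in the list that have all elements of $G$ among their solutions. It is proper if its set of solutions is not the whole of $\mathrm{Aut}(\Delta)$. **Proposition 1.7.** Let $G$ be a subgroup of $\mathrm{Diff}(\mathbb{C},0)$ that has a proper Galois closure on $\Delta$. Then $G$ is solvable. Moreover, the subgroup $G_1=\{g\in G: g'(0)=1\}$ is abelian, and there is a formal vector field $\theta=a(z)\frac{d}{dz}$ with $a\in z^2\mathbb{C}[[z]]$ such that for every $g\in G_1$ there is $c\in\mathbb{C}$ for which the Taylor series of $g$ at $0$ is $\exp(c\,\theta)(z)=\sum_{n\ge 0}\frac{c^n}{n!}\theta^n(z)$. -/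

import Mathlib

open Filter Topology

noncomputable section

namespace GaloisClosure

/-! ### The group `Diff(ℂ, 0)` of germs of analytic diffeomorphisms fixing the origin -/

/-- Germs at `0` of analytic maps `f : (ℂ, 0) → (ℂ, 0)`, possibly not invertible. -/
def MapGerm : Type :=
  {φ : (𝓝 (0 : ℂ)).Germ ℂ // ∃ f : ℂ → ℂ, AnalyticAt ℂ f 0 ∧ f 0 = 0 ∧ φ = (f : (𝓝 (0 : ℂ)).Germ ℂ)}

/-- The germ at `0` of an analytic function fixing `0`. -/
def MapGerm.of (f : ℂ → ℂ) (hf : AnalyticAt ℂ f 0) (h0 : f 0 = 0) : MapGerm :=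
  ⟨(f : (𝓝 (0 : ℂ)).Germ ℂ), f, hf, h0, rfl⟩

/-- A function representing a germ. Everything below depends only on the germ. -/
def MapGerm.rep (φ : MapGerm) : ℂ → ℂ := φ.2.choose

theorem MapGerm.rep_analyticAt (φ : MapGerm) : AnalyticAt ℂ φ.rep 0 := φ.2.choose_spec.1

theorem MapGerm.rep_zero (φ : MapGerm) : φ.rep 0 = 0 := φ.2.choose_spec.2.1

theorem MapGerm.coe_rep (φ : MapGerm) : (φ.rep : (𝓝 (0 : ℂ)).Germ ℂ) = φ.1 :=
  φ.2.choose_spec.2.2.symm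

theorem MapGerm.rep_tendsto (φ : MapGerm) : Tendsto φ.rep (𝓝 0) (𝓝 0) := by
  have h := φ.rep_analyticAt.continuousAt.tendsto
  rwa [φ.rep_zero] at h

theorem MapGerm.ext_rep {φ ψ : MapGerm} (h : φ.rep =ᶠ[𝓝 0] ψ.rep) : φ = ψ := by
  apply Subtype.ext
  rw [← φ.coe_rep, ← ψ.coe_rep]
  exact Germ.coe_eq.2 h

theorem MapGerm.rep_of (f : ℂ → ℂ) (hf : AnalyticAt ℂ f 0) (h0 : f 0 = 0) :
    (MapGerm.of f hf h0).rep =ᶠ[𝓝 0] f :=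
  Germ.coe_eq.1 (MapGerm.of f hf h0).coe_rep

/-- Composition of germs. -/
instance : Mul MapGerm where
  mul φ ψ := MapGerm.of (φ.rep ∘ ψ.rep)
    (AnalyticAt.comp (by rw [ψ.rep_zero]; exact φ.rep_analyticAt) ψ.rep_analyticAt)
    (by simp [ψ.rep_zero, φ.rep_zero])

/-- The germ of the identity. -/
instance : One MapGerm where
  one := MapGerm.of id analyticAt_id rfl

theorem MapGerm.rep_mul (φ ψ : MapGerm) : (φ * ψ).rep =ᶠ[𝓝 0] φ.rep ∘ ψ.rep :=
  MapGerm.rep_of _ _ _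

theorem MapGerm.rep_one : (1 : MapGerm).rep =ᶠ[𝓝 0] id :=
  MapGerm.rep_of _ _ _

instance : Monoid MapGerm where
  mul_assoc a b c := by
    apply MapGerm.ext_rep
    have h1 : (a * b).rep ∘ c.rep =ᶠ[𝓝 0] (a.rep ∘ b.rep) ∘ c.rep :=
      (MapGerm.rep_mul a b).comp_tendsto c.rep_tendsto
    have h2 : a.rep ∘ (b * c).rep =ᶠ[𝓝 0] a.rep ∘ (b.rep ∘ c.rep) :=
      (MapGerm.rep_mul b c).fun_comp a.rep
    exact ((MapGerm.rep_mul (a * b) c).trans h1).trans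
      ((MapGerm.rep_mul a (b * c)).trans h2).symm
  one_mul a := by
    apply MapGerm.ext_rep
    exact (MapGerm.rep_mul 1 a).trans (MapGerm.rep_one.comp_tendsto a.rep_tendsto)
  mul_one a := by
    apply MapGerm.ext_rep
    exact (MapGerm.rep_mul a 1).trans (MapGerm.rep_one.fun_comp a.rep)

/-- `Diff(ℂ, 0)`: the group, under composition, of the germs of analytic maps
`(ℂ, 0) → (ℂ, 0)` that have an analytic inverse germ. -/
abbrev Diff : Type := MapGermˣ

/-- A function representing the germ `g`. -/
def Diff.rep (g : Diff) : ℂ → ℂ := (g : MapGerm).rep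

theorem Diff.deriv_rep_mul (g h : Diff) :
    deriv (Diff.rep (g * h)) 0 = deriv (Diff.rep g) 0 * deriv (Diff.rep h) 0 := by
  have e : Diff.rep (g * h) =ᶠ[𝓝 0] Diff.rep g ∘ Diff.rep h :=
    MapGerm.rep_mul (g : MapGerm) (h : MapGerm)
  have h0 : Diff.rep h 0 = 0 := MapGerm.rep_zero _
  have hg : DifferentiableAt ℂ (Diff.rep g) (Diff.rep h 0) := by
    rw [h0]; exact (MapGerm.rep_analyticAt _).differentiableAt
  rw [e.deriv_eq, deriv_comp 0 hg (MapGerm.rep_analyticAt _).differentiableAt, h0]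

theorem Diff.deriv_rep_one : deriv (Diff.rep 1) 0 = 1 := by
  have e : Diff.rep 1 =ᶠ[𝓝 0] id := MapGerm.rep_one
  rw [e.deriv_eq]
  simp

/-- The subgroup of `Diff(ℂ, 0)` of the germs tangent to the identity: `g'(0) = 1`. -/
def tangentToId : Subgroup Diff where
  carrier := {g | deriv g.rep 0 = 1}
  mul_mem' {g h} hg hh := by
    change deriv (Diff.rep (g * h)) 0 = 1
    rw [Diff.deriv_rep_mul, show deriv (Diff.rep g) 0 = 1 from hg,
      show deriv (Diff.rep h) 0 = 1 from hh, one_mul]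
  one_mem' := Diff.deriv_rep_one
  inv_mem' {g} hg := by
    change deriv (Diff.rep g⁻¹) 0 = 1
    have h := Diff.deriv_rep_mul g g⁻¹
    rw [mul_inv_cancel, Diff.deriv_rep_one, show deriv (Diff.rep g) 0 = 1 from hg, one_mul] at h
    exact h.symm

/-! ### The D-groupoids on a disc -/

/-- `Aut(Δ)` for the disc `Δ` of radius `r` around `0`: the germs of invertible holomorphic maps
from `Δ` to itself. The pair `(a, f)` stands for the germ at the point `a` of the function `f`. -/
def autDisc (r : ℝ) : Set (ℂ × (ℂ → ℂ)) :=
  {p | p.1 ∈ Metric.ball (0 : ℂ) r ∧ AnalyticAt ℂ p.2 p.1 ∧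
    p.2 p.1 ∈ Metric.ball (0 : ℂ) r ∧ deriv p.2 p.1 ≠ 0}

/-- The list of the D-groupoids on the disc `Δ` of radius `r` around `0`. -/
inductive DGroupoid (r : ℝ) : Type
  /-- `G₀(h)`, `h` holomorphic on `Δ`. -/
  | order0 (h : ℂ → ℂ) (hh : DifferentiableOn ℂ h (Metric.ball 0 r))
  /-- `G₁ⁿ(η)`, `n` an integer, `η` meromorphic on `Δ`. -/
  | order1 (n : ℤ) (η : ℂ → ℂ) (hη : MeromorphicOn η (Metric.ball 0 r))
  /-- `G₂(μ)`, `μ` meromorphic on `Δ`. -/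
  | order2 (μ : ℂ → ℂ) (hμ : MeromorphicOn μ (Metric.ball 0 r))
  /-- `G₃(ν)`, `ν` meromorphic on `Δ`. -/
  | order3 (ν : ℂ → ℂ) (hν : MeromorphicOn ν (Metric.ball 0 r))
  /-- `G_∞`. -/
  | infinite

/-- The differential equation of a D-groupoid, for `y = f(x)`, at the point `x`. -/
def DGroupoid.Equation {r : ℝ} (D : DGroupoid r) (f : ℂ → ℂ) (x : ℂ) : Prop :=
  match D with
  | .order0 h _ => h x - h (f x) = 0
  | .order1 n η _ => η (f x) * deriv f x ^ n - η x = 0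
  | .order2 μ _ => μ (f x) * deriv f x + iteratedDeriv 2 f x / deriv f x - μ x = 0
  | .order3 ν _ =>
      ν (f x) * deriv f x ^ 2 + 2 * (iteratedDeriv 3 f x / deriv f x)
        - 3 * (iteratedDeriv 2 f x / deriv f x) ^ 2 - ν x = 0
  | .infinite => (0 : ℂ) = 0

/-- The solutions of a D-groupoid: the germs in `Aut(Δ)` that satisfy its equation. As the
coefficients may have a pole at the base point or at its image, the equation is required on a
punctured neighbourhood of the base point. -/
def DGroupoid.sol {r : ℝ} (D : DGroupoid r) : Set (ℂ × (ℂ → ℂ)) :=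
  {p | p ∈ autDisc r ∧ ∀ᶠ x in 𝓝[≠] p.1, D.Equation p.2 x}

/-- All the elements of `G` are solutions of `D`. -/
def DGroupoid.Admits {r : ℝ} (D : DGroupoid r) (G : Subgroup Diff) : Prop :=
  ∀ g ∈ G, ((0 : ℂ), g.rep) ∈ D.sol

/-- The Galois closure `Gal(G)` on the disc of radius `r`, given by its solutions: the common
solutions of all the D-groupoids that admit every element of `G`. These are the solutions of the
smallest such D-groupoid (`galoisClosure_eq_sol`). -/
def galoisClosure (r : ℝ) (G : Subgroup Diff) : Set (ℂ × (ℂ → ℂ)) :=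
  {p | ∀ D : DGroupoid r, D.Admits G → p ∈ D.sol}

/-- If `D` is the smallest D-groupoid that admits `G`, then `Gal(G)` is `D`. -/
theorem galoisClosure_eq_sol {r : ℝ} {G : Subgroup Diff} (D : DGroupoid r) (hD : D.Admits G)
    (hmin : ∀ D' : DGroupoid r, D'.Admits G → D.sol ⊆ D'.sol) : galoisClosure r G = D.sol :=
  Set.Subset.antisymm (fun _ hp => hp D hD) (fun _ hp D' hD' => hmin D' hD' hp)

/-- The Galois closure of `G` is proper: it is not the whole of `Aut(Δ)`. -/
def HasProperGaloisClosure (r : ℝ) (G : Subgroup Diff) : Prop :=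
  galoisClosure r G ≠ autDisc r

/-! ### Formal vector fields and their exponentials -/

/-- The Taylor series at `0` of a germ. -/
def Diff.taylor (g : Diff) : PowerSeries ℂ :=
  PowerSeries.mk fun k => iteratedDeriv k g.rep 0 / (k.factorial : ℂ)

/-- The action `φ ↦ a · dφ/dz` of the formal vector field `θ = a(z) d/dz` on formal series. -/
def vectorField (a : PowerSeries ℂ) (φ : PowerSeries ℂ) : PowerSeries ℂ :=
  a * PowerSeries.derivative ℂ φ

/-- `φ` is `exp(c θ)` for the formal vector field `θ = a(z) d/dz`: it is the sum, coefficient by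
coefficient, of the exponential series `∑ₙ (cⁿ / n!) θⁿ(z)`. -/
def IsExp (c : ℂ) (a : PowerSeries ℂ) (φ : PowerSeries ℂ) : Prop :=
  ∀ k : ℕ, HasSum
    (fun n : ℕ => c ^ n / (n.factorial : ℂ) *
      PowerSeries.coeff k ((vectorField a)^[n] PowerSeries.X))
    (PowerSeries.coeff k φ)

end GaloisClosure

end

open Filter Topology

noncomputable section

namespace GaloisClosure

/-! ### Algebra endomorphisms of `ℂ[[X]]` -/

/-! Properness yields a single D-groupoid `D` in the list that admits $G$ and is not all of
$\mathrm{Aut}(\Delta)$. Let $f=z+bz^{j+1}+\cdots$, $b\ne 0$, solve the equation of `D`. Comparing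
leading terms at $0$ makes $b$ drop out and expresses $j$ through the order at $0$ of the
coefficient of `D`, or through its leading coefficient (`DGroupoid.contact_order_unique`). So all
nontrivial elements of $G_1$ share one $j$.

The leading coefficient $g\mapsto b$ is then an injective additive character of $G_1$, which is
therefore abelian (`HasContactOrder.commute`). As $G_1$ is the kernel of $g\mapsto g'(0)$ on $G$,
the group $G$ is abelian-by-abelian.

For the vector field, fix $g\ne 1$ in $G_1$ and write $g=\exp\theta$ formally
(`exists_formalExp_eq`). Any $h\in G_1$ commutes with $g$, and so does $\exp(c\theta)$. With $c$ the
ratio of leading coefficients the two agree through degree $j+1$, and an element of the centralizer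
of $g$ tangent to the identity is determined by its coefficient in that degree
(`eq_of_commute_of_dvd_sub`). -/

open PowerSeries in
theorem eq_zero_of_forall_X_pow_dvd {φ : PowerSeries ℂ} (h : ∀ n, X ^ n ∣ φ) : φ = 0 := by
  ext k
  simpa using X_pow_dvd_iff.1 (h (k + 1)) k (Nat.lt_succ_self k)

open PowerSeries in
theorem algHom_apply_eq (σ : PowerSeries ℂ →ₐ[ℂ] PowerSeries ℂ) (φ : PowerSeries ℂ) :
    σ φ = σ X * σ (mk fun p => coeff (p + 1) φ) + C (constantCoeff φ) := by
  conv_lhs => rw [φ.eq_X_mul_shift_add_const]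
  rw [map_add, map_mul]
  congr 1
  exact σ.commutes _

-- No continuity is assumed: peeling off the constant term, $\varphi=X\psi+c$, reduces $\varphi$ to
-- $\psi$, and the factor $\tau(X)$ supplies one power of $X$ at each step.
open PowerSeries in
theorem X_pow_dvd_algHom_sub {σ τ : PowerSeries ℂ →ₐ[ℂ] PowerSeries ℂ} (hτ : X ∣ τ X) {m : ℕ}
    (h : X ^ m ∣ σ X - τ X) (φ : PowerSeries ℂ) : X ^ m ∣ σ φ - τ φ := by
  suffices H : ∀ N ≤ m, ∀ φ : PowerSeries ℂ, X ^ N ∣ σ φ - τ φ from H m le_rfl φ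
  intro N
  induction N with
  | zero => simp
  | succ N ih =>
    intro hN φ
    set ψ : PowerSeries ℂ := mk fun p => coeff (p + 1) φ
    have e : σ φ - τ φ = (σ X - τ X) * σ ψ + τ X * (σ ψ - τ ψ) := by
      rw [algHom_apply_eq σ, algHom_apply_eq τ]; ring
    rw [e]
    refine dvd_add (((pow_dvd_pow X hN).trans h).mul_right _) ?_
    rw [pow_succ']
    exact mul_dvd_mul hτ (ih (by omega) _)

open PowerSeries in
theorem algHom_ext_X {σ τ : PowerSeries ℂ →ₐ[ℂ] PowerSeries ℂ} (hτ : X ∣ τ X)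
    (h : σ X = τ X) : σ = τ := by
  ext1 φ
  refine sub_eq_zero.1 (eq_zero_of_forall_X_pow_dvd fun n => ?_)
  exact X_pow_dvd_algHom_sub hτ (by simp [h]) φ

/-! ### The flow of a formal vector field -/

section Flow

open PowerSeries Finset

theorem _root_.Derivation.iterate_mul {R A : Type*} [CommSemiring R] [CommSemiring A] [Algebra R A]
    (D : Derivation R A A) (n : ℕ) (x y : A) :
    D^[n] (x * y) = ∑ ij ∈ antidiagonal n, n.choose ij.1 • (D^[ij.1] x * D^[ij.2] y) := by
  induction n with
  | zero => simp
  | succ n ih =>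
    rw [sum_antidiagonal_choose_succ_nsmul (M := A) (fun i j => D^[i] x * D^[j] y) n]
    simp only [Function.iterate_succ_apply', ih, map_sum, map_nsmul, Derivation.leibniz, smul_add,
      sum_add_distrib, smul_eq_mul]
    congr 1
    refine sum_congr rfl fun ⟨i, j⟩ hij ↦ ?_
    rw [n.choose_symm_of_eq_add (HasAntidiagonal.mem_antidiagonal.1 hij).symm, mul_comm]

/-- The vector field `a(z) d/dz`, as a derivation. -/
def vectorFieldDer (a : PowerSeries ℂ) : Derivation ℂ (PowerSeries ℂ) (PowerSeries ℂ) :=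
  a • PowerSeries.derivative ℂ

theorem coe_vectorFieldDer (a : PowerSeries ℂ) : ⇑(vectorFieldDer a) = vectorField a := rfl

theorem vectorField_iterate_mul (a : PowerSeries ℂ) (n : ℕ) (φ ψ : PowerSeries ℂ) :
    (vectorField a)^[n] (φ * ψ) = ∑ ij ∈ antidiagonal n,
      n.choose ij.1 • ((vectorField a)^[ij.1] φ * (vectorField a)^[ij.2] ψ) := by
  rw [← coe_vectorFieldDer, Derivation.iterate_mul]

theorem vectorField_iterate_eq_pow (a : PowerSeries ℂ) (n : ℕ) (φ : PowerSeries ℂ) :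
    (vectorField a)^[n] φ = ((vectorFieldDer a : PowerSeries ℂ →ₗ[ℂ] PowerSeries ℂ) ^ n) φ := by
  rw [Module.End.pow_apply]; rfl

theorem vectorField_X (a : PowerSeries ℂ) : vectorField a X = a := by
  simp [vectorField]

theorem X_pow_dvd_vectorField {a φ : PowerSeries ℂ} {i j : ℕ} (ha : X ^ (j + 1) ∣ a)
    (hφ : X ^ i ∣ φ) : X ^ (i + j) ∣ vectorField a φ := by
  obtain ⟨α, rfl⟩ := ha
  obtain ⟨ψ, rfl⟩ := hφ
  rcases i with _ | i
  · rw [zero_add, vectorField, pow_succ, mul_assoc, mul_assoc]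
    exact dvd_mul_right _ _
  · rw [vectorField, Derivation.leibniz, PowerSeries.derivative_pow]
    refine ⟨α * (X * derivative ℂ ψ + ((i + 1 : ℕ) : PowerSeries ℂ) * ψ), ?_⟩
    simp only [smul_eq_mul, add_tsub_cancel_right, derivative_X]
    ring

theorem X_pow_dvd_vectorField_iterate {a φ : PowerSeries ℂ} {i j : ℕ} (ha : X ^ (j + 1) ∣ a)
    (hφ : X ^ i ∣ φ) (n : ℕ) : X ^ (i + n * j) ∣ (vectorField a)^[n] φ := by
  induction n with
  | zero => simpa using hφ
  | succ n ih =>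
    rw [Function.iterate_succ_apply', add_mul, one_mul, ← add_assoc]
    exact X_pow_dvd_vectorField ha ih

/-- Each application of $\theta$ raises the order by at least one, so every coefficient of the
exponential series is a finite sum and convergence is never an issue. -/
theorem coeff_vectorField_iterate_of_lt {a : PowerSeries ℂ} (ha : X ^ 2 ∣ a) {k n : ℕ} (h : k < n)
    (φ : PowerSeries ℂ) : coeff k ((vectorField a)^[n] φ) = 0 := by
  have := X_pow_dvd_vectorField_iterate (i := 0) (j := 1) ha (φ := φ) (by simp) n
  exact X_pow_dvd_iff.1 this k (by omega)

/-- `exp(c θ)(φ)` for the formal vector field `θ = a(z) d/dz` with `a ∈ z²ℂ[[z]]`. -/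
def formalExp (c : ℂ) (a φ : PowerSeries ℂ) : PowerSeries ℂ :=
  mk fun k => ∑ n ∈ range (k + 1), c ^ n / (n.factorial : ℂ) * coeff k ((vectorField a)^[n] φ)

/-- A partial sum of the exponential series, as a linear map. -/
def partialExp (N : ℕ) (c : ℂ) (a : PowerSeries ℂ) : PowerSeries ℂ →ₗ[ℂ] PowerSeries ℂ :=
  ∑ n ∈ range N, (c ^ n / (n.factorial : ℂ)) •
    (vectorFieldDer a : PowerSeries ℂ →ₗ[ℂ] PowerSeries ℂ) ^ n

theorem partialExp_apply (N : ℕ) (c : ℂ) (a φ : PowerSeries ℂ) :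
    partialExp N c a φ =
      ∑ n ∈ range N, (c ^ n / (n.factorial : ℂ)) • (vectorField a)^[n] φ := by
  simp [partialExp, vectorField_iterate_eq_pow]

theorem X_pow_dvd_partialExp {a : PowerSeries ℂ} (ha : X ^ 2 ∣ a) (N : ℕ) (c : ℂ)
    {φ : PowerSeries ℂ} {i : ℕ} (hφ : X ^ i ∣ φ) : X ^ i ∣ partialExp N c a φ := by
  rw [partialExp_apply]
  refine dvd_sum fun n _ => ?_
  rw [smul_eq_C_mul]
  exact ((pow_dvd_pow X (by omega)).trans
    (X_pow_dvd_vectorField_iterate (j := 1) ha hφ n)).mul_left _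

theorem coeff_formalExp {a : PowerSeries ℂ} (ha : X ^ 2 ∣ a) (c : ℂ) (φ : PowerSeries ℂ) {k N : ℕ}
    (h : k < N) : coeff k (formalExp c a φ) = coeff k (partialExp N c a φ) := by
  rw [formalExp, coeff_mk, partialExp_apply, map_sum]
  simp only [coeff_smul, smul_eq_mul]
  refine sum_subset (range_mono (by omega)) fun n _ hn => ?_
  rw [coeff_vectorField_iterate_of_lt ha (by simpa using hn), mul_zero]

theorem X_pow_dvd_formalExp_sub_partialExp {a : PowerSeries ℂ} (ha : X ^ 2 ∣ a) (c : ℂ)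
    (φ : PowerSeries ℂ) (N : ℕ) : X ^ N ∣ formalExp c a φ - partialExp N c a φ := by
  refine X_pow_dvd_iff.2 fun k hk => ?_
  rw [map_sub, coeff_formalExp ha c φ hk, sub_self]

theorem isExp_formalExp {a : PowerSeries ℂ} (ha : X ^ 2 ∣ a) (c : ℂ) :
    IsExp c a (formalExp c a X) := by
  intro k
  rw [formalExp, coeff_mk]
  refine hasSum_sum_of_ne_finset_zero fun n hn => ?_
  rw [coeff_vectorField_iterate_of_lt ha (by simpa using hn), mul_zero]

/-- Modulo $X^N$ the exponentials may be truncated. The product of truncations is a sum over a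
square of pairs $(i,j)$: the triangle $i+j<N$ is the truncation of the product, by Leibniz, and the
remaining terms are divisible by $X^{i+j}$. -/
theorem formalExp_mul {a : PowerSeries ℂ} (ha : X ^ 2 ∣ a) (c : ℂ) (φ ψ : PowerSeries ℂ) :
    formalExp c a (φ * ψ) = formalExp c a φ * formalExp c a ψ := by
  refine sub_eq_zero.1 (eq_zero_of_forall_X_pow_dvd fun N => ?_)
  have h1 := X_pow_dvd_formalExp_sub_partialExp ha c (φ * ψ) N
  have h2 : X ^ N ∣ formalExp c a φ * formalExp c a ψ - partialExp N c a φ * partialExp N c a ψ := by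
    have e : formalExp c a φ * formalExp c a ψ - partialExp N c a φ * partialExp N c a ψ =
      (formalExp c a φ - partialExp N c a φ) * formalExp c a ψ +
        partialExp N c a φ * (formalExp c a ψ - partialExp N c a ψ) := by ring
    rw [e]
    exact dvd_add ((X_pow_dvd_formalExp_sub_partialExp ha c φ N).mul_right _)
      ((X_pow_dvd_formalExp_sub_partialExp ha c ψ N).mul_left _)
  have h3 : X ^ N ∣ partialExp N c a φ * partialExp N c a ψ - partialExp N c a (φ * ψ) := by
    set f : ℕ × ℕ → PowerSeries ℂ := fun p =>
      (c ^ (p.1 + p.2) / (p.1.factorial * p.2.factorial : ℂ)) •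
        ((vectorField a)^[p.1] φ * (vectorField a)^[p.2] ψ) with hf
    have e1 : partialExp N c a φ * partialExp N c a ψ = ∑ p ∈ range N ×ˢ range N, f p := by
      rw [partialExp_apply, partialExp_apply, sum_mul_sum, sum_product]
      refine sum_congr rfl fun i _ => sum_congr rfl fun j _ => ?_
      simp only [hf, smul_mul_smul_comm, pow_add, div_mul_div_comm]
    have e2 : partialExp N c a (φ * ψ) =
        ∑ p ∈ (range N ×ˢ range N).filter (fun p => p.1 + p.2 < N), f p := by
      rw [partialExp_apply, ← sum_fiberwise_of_maps_to (t := range N) (g := fun p : ℕ × ℕ => p.1 + p.2)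
        (by intro p hp; simpa using (mem_filter.1 hp).2)]
      refine sum_congr rfl fun n hn => ?_
      have hs : ((range N ×ˢ range N).filter (fun p => p.1 + p.2 < N)).filter
          (fun p => p.1 + p.2 = n) = antidiagonal n := by
        ext ⟨i, j⟩
        simp only [mem_filter, mem_product, mem_range, HasAntidiagonal.mem_antidiagonal] at hn ⊢
        omega
      rw [hs, vectorField_iterate_mul, smul_sum]
      refine sum_congr rfl fun p hp => ?_
      rw [HasAntidiagonal.mem_antidiagonal] at hp
      simp only [hf, ← Nat.cast_smul_eq_nsmul ℂ, smul_smul, hp]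
      congr 1
      have hc := Nat.add_choose_mul_factorial_mul_factorial p.1 p.2
      rw [hp, ← Nat.choose_symm_of_eq_add hp.symm] at hc
      have h1 : (p.1.factorial : ℂ) ≠ 0 := by exact_mod_cast p.1.factorial_ne_zero
      have h2 : (p.2.factorial : ℂ) ≠ 0 := by exact_mod_cast p.2.factorial_ne_zero
      have h3 : (n.factorial : ℂ) ≠ 0 := by exact_mod_cast n.factorial_ne_zero
      field_simp
      rw [← hc]
      push_cast
      ring
    rw [e1, e2, ← sum_filter_add_sum_filter_not (range N ×ˢ range N) (fun p => p.1 + p.2 < N),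
      add_sub_cancel_left]
    refine dvd_sum fun p hp => ?_
    have hp : N ≤ p.1 + p.2 := by simpa using (mem_filter.1 hp).2
    simp only [hf, smul_eq_C_mul]
    refine Dvd.dvd.mul_left ((pow_dvd_pow X hp).trans ?_) _
    rw [pow_add]
    refine mul_dvd_mul ?_ ?_
    · simpa using X_pow_dvd_vectorField_iterate (i := 0) (j := 1) ha (φ := φ) (by simp) p.1
    · simpa using X_pow_dvd_vectorField_iterate (i := 0) (j := 1) ha (φ := ψ) (by simp) p.2
  have := dvd_sub h1 (dvd_add h2 h3)
  convert this using 1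
  ring

/-- `exp(c θ)` as an algebra endomorphism of `ℂ[[z]]`. -/
def formalExpHom (c : ℂ) {a : PowerSeries ℂ} (ha : X ^ 2 ∣ a) :
    PowerSeries ℂ →ₐ[ℂ] PowerSeries ℂ :=
  AlgHom.ofLinearMap
    { toFun := formalExp c a
      map_add' := fun φ ψ => by
        ext k
        simp only [map_add, coeff_formalExp ha c _ (Nat.lt_succ_self k)]
      map_smul' := fun r φ => by
        ext k
        simp only [map_smul, RingHom.id_apply,
          coeff_formalExp ha c _ (Nat.lt_succ_self k)] }
    (by
      ext k
      change coeff k (formalExp c a 1) = _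
      rw [coeff_formalExp ha c _ (Nat.lt_succ_self k), partialExp_apply, sum_range_succ']
      have h : ∀ n, (vectorField a)^[n + 1] 1 = 0 := fun n => by
        rw [Function.iterate_succ_apply, ← coe_vectorFieldDer, Derivation.map_one_eq_zero,
          iterate_map_zero]
      simp [h])
    (formalExp_mul ha c)

theorem formalExpHom_apply (c : ℂ) {a : PowerSeries ℂ} (ha : X ^ 2 ∣ a) (φ : PowerSeries ℂ) :
    formalExpHom c ha φ = formalExp c a φ := rfl

/-- The truncations are polynomials in one derivation, hence commute; they also preserve
divisibility by $X^N$, so truncation errors do not grow. -/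
theorem formalExp_comm {a : PowerSeries ℂ} (ha : X ^ 2 ∣ a) (c d : ℂ) (φ : PowerSeries ℂ) :
    formalExp c a (formalExp d a φ) = formalExp d a (formalExp c a φ) := by
  have key : ∀ (c d : ℂ) (N : ℕ), X ^ N ∣
      formalExp c a (formalExp d a φ) - partialExp N c a (partialExp N d a φ) := by
    intro c d N
    have h1 := X_pow_dvd_formalExp_sub_partialExp ha c (formalExp d a φ) N
    have h2 := X_pow_dvd_partialExp ha N c (X_pow_dvd_formalExp_sub_partialExp ha d φ N)
    rw [map_sub] at h2
    simpa using dvd_add h1 h2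
  have hc : ∀ N, partialExp N c a (partialExp N d a φ) = partialExp N d a (partialExp N c a φ) := by
    intro N
    have : Commute (partialExp N c a) (partialExp N d a) := by
      refine Commute.sum_left _ _ _ fun i _ => Commute.sum_right _ _ _ fun j _ => ?_
      exact ((Commute.refl _).pow_pow i j).smul_left _ |>.smul_right _
    exact LinearMap.congr_fun this.eq φ
  refine sub_eq_zero.1 (eq_zero_of_forall_X_pow_dvd fun N => ?_)
  have := dvd_sub (key c d N) (key d c N)
  rw [hc N] at this
  simpa using this

/-- `exp(c θ)(z) = z + c a_l z^l + ⋯` when `a = a_l z^l + ⋯`. -/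
theorem X_pow_dvd_formalExp_X_sub {a : PowerSeries ℂ} {l : ℕ} (hl : 2 ≤ l) (ha : X ^ l ∣ a)
    (c : ℂ) : X ^ (l + 1) ∣ formalExp c a X - (X + c • a) := by
  have ha2 : X ^ 2 ∣ a := (pow_dvd_pow X hl).trans ha
  have h1 := X_pow_dvd_formalExp_sub_partialExp ha2 c X (l + 1)
  have h2 : X ^ (l + 1) ∣ partialExp (l + 1) c a X - (X + c • a) := by
    obtain ⟨j, rfl⟩ : ∃ j, l = j + 2 := ⟨l - 2, by omega⟩
    rw [partialExp_apply, sum_range_succ', sum_range_succ']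
    simp only [Function.iterate_succ_apply, Function.iterate_zero, id_eq, vectorField_X, zero_add,
      pow_one, Nat.factorial_one, Nat.cast_one, div_one, pow_zero, Nat.factorial_zero, one_smul]
    rw [show ∀ s : PowerSeries ℂ, s + c • a + X - (X + c • a) = s from fun s => by ring]
    -- Only terms $\theta^n(X)$ with $n\ge 2$ remain, and $\theta^2(X)=\theta(a)$ has order at least
    -- $2l-1\ge l+1$.
    refine dvd_sum fun n _ => ?_
    rw [smul_eq_C_mul]
    refine Dvd.dvd.mul_left (Dvd.dvd.trans (pow_dvd_pow X ?_)
      (X_pow_dvd_vectorField_iterate (i := j + 2 + (j + 1)) (j := j + 1) ha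
        (X_pow_dvd_vectorField (j := j + 1) ha ha) n)) _
    omega
  simpa using dvd_add h1 h2

/-- To leading order, perturbing $a$ perturbs $\exp(\theta)(z)$ by the same amount. From $\theta^2$
on, the difference of iterates splits as $(a-b)\varphi'+b(\varphi-\psi)'$, where both terms gain a
power of $X$ because $\varphi$ and $b$ have order at least two. -/
theorem X_pow_dvd_formalExp_sub_of_sub {a b : PowerSeries ℂ} (ha : X ^ 2 ∣ a) (hb : X ^ 2 ∣ b)
    {k : ℕ} (hk : 2 ≤ k) (hab : X ^ k ∣ a - b) :
    X ^ (k + 1) ∣ formalExp 1 a X - formalExp 1 b X - (a - b) := by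
  have hdiff : ∀ (φ ψ : PowerSeries ℂ) (i : ℕ), X ^ 2 ∣ φ → k ≤ i → X ^ i ∣ φ - ψ →
      X ^ (k + 1) ∣ vectorField a φ - vectorField b ψ := by
    intro φ ψ i hφ hi h
    have e : vectorField a φ - vectorField b ψ = vectorField (a - b) φ + vectorField b (φ - ψ) := by
      simp only [vectorField, map_sub]; ring
    rw [e]
    refine dvd_add ?_ ?_
    · obtain ⟨j, rfl⟩ : ∃ j, k = j + 1 := ⟨k - 1, by omega⟩
      refine (pow_dvd_pow X ?_).trans (X_pow_dvd_vectorField (j := j) hab hφ)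
      omega
    · exact (pow_dvd_pow X (by omega)).trans (X_pow_dvd_vectorField (j := 1) hb h)
  have hit : ∀ n, X ^ (k + 1) ∣ (vectorField a)^[n + 2] X - (vectorField b)^[n + 2] X := by
    have hX2 : ∀ n, X ^ 2 ∣ (vectorField a)^[n + 1] X := fun n => by
      rw [Function.iterate_succ_apply, vectorField_X]
      exact (pow_dvd_pow X (by omega)).trans (X_pow_dvd_vectorField_iterate (j := 1) ha ha n)
    intro n
    induction n with
    | zero =>
      simp only [zero_add, Function.iterate_succ_apply, Function.iterate_zero, id_eq, vectorField_X]
      exact hdiff a b k ha le_rfl hab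
    | succ n ih =>
      rw [Function.iterate_succ_apply' _ (n + 2), Function.iterate_succ_apply' _ (n + 2)]
      exact hdiff _ _ (k + 1) (hX2 (n + 1)) (Nat.le_succ k) ih
  have h1 := X_pow_dvd_formalExp_sub_partialExp ha 1 X (k + 1)
  have h2 := X_pow_dvd_formalExp_sub_partialExp hb 1 X (k + 1)
  have h3 : X ^ (k + 1) ∣ partialExp (k + 1) 1 a X - partialExp (k + 1) 1 b X - (a - b) := by
    obtain ⟨j, rfl⟩ : ∃ j, k = j + 2 := ⟨k - 2, by omega⟩
    rw [partialExp_apply, partialExp_apply, ← sum_sub_distrib, sum_range_succ', sum_range_succ']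
    simp only [Function.iterate_succ_apply, Function.iterate_zero, id_eq, vectorField_X, zero_add,
      pow_one, Nat.factorial_one, Nat.cast_one, div_one, pow_zero, Nat.factorial_zero, one_smul,
      sub_self, add_zero, add_sub_cancel_right]
    refine dvd_sum fun n _ => ?_
    rw [← smul_sub, smul_eq_C_mul]
    simpa only [Function.iterate_succ_apply, vectorField_X] using (hit n).mul_left _
  have := dvd_add (dvd_sub h1 h2) h3
  convert this using 1
  ring

/-- Every formal diffeomorphism tangent to the identity is the time-one map of a formal vector
field. -/
theorem exists_formalExp_eq {g : PowerSeries ℂ} (hg : X ^ 2 ∣ g - X) :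
    ∃ a : PowerSeries ℂ, X ^ 2 ∣ a ∧ formalExp 1 a X = g := by
  -- Adding the current error $g-\exp(a\,d/dz)(z)$ to $a$ gains one order of agreement.
  have step : ∀ (N : ℕ) (a : PowerSeries ℂ), 2 ≤ N → X ^ 2 ∣ a → X ^ N ∣ g - formalExp 1 a X →
      ∃ b : PowerSeries ℂ, X ^ 2 ∣ b ∧ X ^ (N + 1) ∣ g - formalExp 1 b X ∧ X ^ N ∣ b - a := by
    intro N a hN ha h
    have hba : X ^ N ∣ (a + (g - formalExp 1 a X)) - a := by simpa using h
    have hb : X ^ 2 ∣ a + (g - formalExp 1 a X) := dvd_add ha ((pow_dvd_pow X hN).trans h)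
    refine ⟨_, hb, ?_, hba⟩
    have := (dvd_neg.2 (X_pow_dvd_formalExp_sub_of_sub hb ha hN hba))
    convert this using 1
    ring
  have h0 : X ^ 2 ∣ g - formalExp 1 0 X := by
    have := X_pow_dvd_formalExp_X_sub (a := 0) le_rfl (dvd_zero _) 1
    rw [smul_zero, add_zero] at this
    simpa using dvd_sub hg ((pow_dvd_pow X (by norm_num)).trans this)
  choose! B hB1 hB2 hB3 using step
  let A : ℕ → PowerSeries ℂ := fun n => Nat.rec 0 (fun n a => B (n + 2) a) n
  have hA : ∀ n, X ^ 2 ∣ A n ∧ X ^ (n + 2) ∣ g - formalExp 1 (A n) X := by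
    intro n
    induction n with
    | zero => exact ⟨dvd_zero _, h0⟩
    | succ n ih =>
      exact ⟨hB1 (n + 2) _ (by omega) ih.1 ih.2, hB2 (n + 2) _ (by omega) ih.1 ih.2⟩
  have hs : ∀ n, X ^ (n + 2) ∣ A (n + 1) - A n := fun n =>
    hB3 (n + 2) _ (by omega) (hA n).1 (hA n).2
  have hd : ∀ n m, X ^ (n + 2) ∣ A (n + m) - A n := by
    intro n m
    induction m with
    | zero => simp
    | succ m ih =>
      have := dvd_add ((pow_dvd_pow X (by omega : n + 2 ≤ n + m + 2)).trans (hs (n + m))) ih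
      simpa [add_assoc] using this
  -- The diagonal is the limit: from stage $k$ on, corrections only touch degrees at least $k+2$, so
  -- the coefficient of degree $k$ is frozen.
  have hlim : ∀ n, X ^ (n + 2) ∣ (PowerSeries.mk fun k => coeff k (A k)) - A n := by
    refine fun n => X_pow_dvd_iff.2 fun k hk => ?_
    rw [map_sub, coeff_mk]
    rcases le_total n k with h | h
    · obtain ⟨m, rfl⟩ := Nat.exists_eq_add_of_le h
      rw [← map_sub]
      exact X_pow_dvd_iff.1 (hd n m) _ hk
    · obtain ⟨m, rfl⟩ := Nat.exists_eq_add_of_le h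
      have := X_pow_dvd_iff.1 (hd k m) k (by omega)
      rw [map_sub] at this
      rw [← neg_sub, this, neg_zero]
  have ha : X ^ 2 ∣ PowerSeries.mk fun k => coeff k (A k) := by
    simpa [A] using hlim 0
  refine ⟨_, ha, (sub_eq_zero.1 (eq_zero_of_forall_X_pow_dvd fun N => ?_)).symm⟩
  have h1 := X_pow_dvd_formalExp_sub_of_sub ha (hA N).1 (Nat.le_add_left 2 N) (hlim N)
  have h2 := dvd_sub (hA N).2 (dvd_add ((pow_dvd_pow X (by omega : N + 2 ≤ N + 2 + 1)).trans h1)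
    (hlim N))
  refine (pow_dvd_pow X (by omega : N ≤ N + 2)).trans ?_
  convert h2 using 1
  ring

end Flow

/-! ### The centralizer of a formal diffeomorphism tangent to the identity -/

section Centralizer

open PowerSeries

/-- A formal diffeomorphism tangent to the identity that commutes with `g = z + b z^l + ⋯`, `b ≠ 0`,
is determined by its coefficient of degree `l`. -/
theorem eq_of_commute_of_dvd_sub {σ τ ρ : PowerSeries ℂ →ₐ[ℂ] PowerSeries ℂ} {l : ℕ}
    (hl : 2 ≤ l) {u : PowerSeries ℂ} (hu : constantCoeff u ≠ 0) (hρ : ρ X = X + X ^ l * u)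
    (hσX : X ^ 2 ∣ σ X - X) (hτX : X ^ 2 ∣ τ X - X)
    (hσ : ρ (σ X) = σ (ρ X)) (hτ : ρ (τ X) = τ (ρ X)) (h : X ^ (l + 1) ∣ σ X - τ X) :
    σ X = τ X := by
  by_contra hne
  have hd : σ X - τ X ≠ 0 := sub_ne_zero.2 hne
  -- Here $m$ is the order of the difference. The hypothesis gives $m>l$; commutation with `ρ` will
  -- force $m=l$.
  obtain ⟨m, w, hw, hm⟩ : ∃ m : ℕ, ∃ w : PowerSeries ℂ, constantCoeff w ≠ 0 ∧
      σ X - τ X = X ^ m * w := by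
    refine ⟨_, _, ?_, (X_pow_order_mul_divXPowOrder (f := σ X - τ X)).symm⟩
    rw [constantCoeff_divXPowOrder]
    exact coeff_order hd
  have hlm : l < m := by
    by_contra hlt
    rw [hm] at h
    have := X_pow_dvd_iff.1 h m (by omega)
    rw [coeff_X_pow_mul', if_pos le_rfl, Nat.sub_self] at this
    exact hw (by simpa using this)
  obtain ⟨s, hs⟩ := hσX
  obtain ⟨t, ht⟩ := hτX
  have hs : σ X = X * (1 + X * s) := by linear_combination hs
  have ht : τ X = X * (1 + X * t) := by linear_combination ht
  have hXτ : X ∣ τ X := ⟨_, ht⟩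
  obtain ⟨j, rfl⟩ : ∃ j, l = j + 1 := ⟨l - 1, by omega⟩
  -- the two ways of expanding `ρ (σ X - τ X)`
  have e1 : ρ (σ X - τ X) = X ^ m * ((1 + X ^ j * u) ^ m * ρ w) := by
    rw [hm, map_mul, map_pow, hρ, ← mul_assoc, ← mul_pow]
    ring
  have e2 : ρ (σ X - τ X) = σ X - τ X + ((σ X ^ (j + 1) - τ X ^ (j + 1)) * σ u +
      τ X ^ (j + 1) * (σ u - τ u)) := by
    rw [map_sub, hσ, hτ, hρ]
    simp only [map_add, map_mul, map_pow]
    ring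
  obtain ⟨q, hq⟩ := X_pow_dvd_algHom_sub hXτ (m := m) ⟨w, hm⟩ u
  have e3 : σ X ^ (j + 1) - τ X ^ (j + 1) =
      X ^ (m + j) * (w * ∑ i ∈ Finset.range (j + 1), (1 + X * s) ^ i * (1 + X * t) ^ (j - i)) := by
    rw [← (Commute.all (σ X) (τ X)).geom_sum₂_mul, hm, Finset.mul_sum, Finset.mul_sum,
      Finset.sum_mul]
    refine Finset.sum_congr rfl fun i hi => ?_
    have hi : i ≤ j := by simpa [Nat.lt_succ_iff] using hi
    rw [hs, ht, mul_pow, mul_pow, Nat.add_sub_cancel]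
    have : (X : PowerSeries ℂ) ^ j = X ^ i * X ^ (j - i) := by rw [← pow_add]; congr 1; omega
    rw [pow_add, this]
    ring
  -- Binomial expansion; its remainder has order $2j\ge j+1$ because $l\ge 2$.
  obtain ⟨v, hv⟩ : ∃ v : PowerSeries ℂ,
      (1 + X ^ j * u) ^ m = 1 + X ^ j * ((m : PowerSeries ℂ) * u) + X ^ (j + 1) * v := by
    obtain ⟨i, rfl⟩ : ∃ i, j = i + 1 := ⟨j - 1, by omega⟩
    obtain ⟨v, hv⟩ := Polynomial.powAddExpansion 1 (X ^ (i + 1) * u) m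
    refine ⟨X ^ i * u ^ 2 * v, ?_⟩
    rw [hv]
    ring
  obtain ⟨p, hp⟩ := X_pow_dvd_algHom_sub (σ := ρ) (τ := AlgHom.id ℂ _) (m := j + 1) (by simp)
    ⟨u, by rw [hρ]; simp⟩ w
  have hp : ρ w = w + X ^ (j + 1) * p := by
    rw [← hp]; simp
  -- Both expansions divided by $X^{m+j}$. At $0$ this reads $m\,uw=(j+1)\,uw$, the formal
  -- counterpart of $[z^l\partial,z^m\partial]=(m-l)z^{l+m-1}\partial$.
  have e4 : (m : PowerSeries ℂ) * u * w + X * ((1 + X ^ j * ((m : PowerSeries ℂ) * u)) * p + v * ρ w) =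
      w * (∑ i ∈ Finset.range (j + 1), (1 + X * s) ^ i * (1 + X * t) ^ (j - i)) * σ u +
      X * ((1 + X * t) ^ (j + 1) * q) := by
    have hXX : (X : PowerSeries ℂ) ^ (m + j) ≠ 0 := pow_ne_zero _ X_ne_zero
    refine mul_left_cancel₀ hXX ?_
    have E := e1.symm.trans e2
    rw [e3, hq, hv, hm] at E
    rw [ht, mul_pow X (1 + X * t)] at E
    linear_combination E - X ^ m * (1 + X ^ j * ((m : PowerSeries ℂ) * u)) * hp
  have e5 := congrArg constantCoeff e4
  have hσu : constantCoeff (σ u) = constantCoeff u := by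
    rw [algHom_apply_eq, hs]; simp
  simp only [map_add, map_mul, hσu, constantCoeff_X, zero_mul, add_zero, map_natCast, map_sum,
    map_pow, map_one, one_pow, mul_one, Finset.sum_const, Finset.card_range, nsmul_eq_mul] at e5
  have : (m : ℂ) = (j + 1 : ℕ) := by
    refine mul_right_cancel₀ (mul_ne_zero hu hw) ?_
    linear_combination e5
  have := Nat.cast_injective this
  omega

end Centralizer

/-! ### Taylor series of analytic functions -/

/-- The Taylor series at `0` of a function. -/
def taylorSeries (f : ℂ → ℂ) : PowerSeries ℂ :=
  PowerSeries.mk fun k => iteratedDeriv k f 0 / (k.factorial : ℂ)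

theorem Diff.taylor_eq (g : Diff) : g.taylor = taylorSeries g.rep := rfl

theorem taylorSeries_congr {f g : ℂ → ℂ} (h : f =ᶠ[𝓝 0] g) : taylorSeries f = taylorSeries g := by
  ext k
  simp only [taylorSeries, PowerSeries.coeff_mk, h.iteratedDeriv_eq k]

theorem taylorSeries_const (c : ℂ) : taylorSeries (fun _ => c) = PowerSeries.C c := by
  ext k
  rw [taylorSeries, PowerSeries.coeff_mk, iteratedDeriv_const, PowerSeries.coeff_C]
  split_ifs with h <;> simp [h]

theorem taylorSeries_id : taylorSeries (fun z => z) = PowerSeries.X := by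
  ext k
  rw [taylorSeries, PowerSeries.coeff_mk, iteratedDeriv_fun_id_zero, PowerSeries.coeff_X]
  split_ifs with h <;> simp [h]

theorem taylorSeries_add {f g : ℂ → ℂ} (hf : AnalyticAt ℂ f 0) (hg : AnalyticAt ℂ g 0) :
    taylorSeries (fun z => f z + g z) = taylorSeries f + taylorSeries g := by
  ext k
  rw [map_add]
  simp only [taylorSeries, PowerSeries.coeff_mk]
  rw [iteratedDeriv_fun_add hf.contDiffAt hg.contDiffAt, add_div]

theorem taylorSeries_mul {f g : ℂ → ℂ} (hf : AnalyticAt ℂ f 0) (hg : AnalyticAt ℂ g 0) :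
    taylorSeries (fun z => f z * g z) = taylorSeries f * taylorSeries g := by
  ext k
  rw [PowerSeries.coeff_mul, Finset.Nat.sum_antidiagonal_eq_sum_range_succ_mk]
  simp only [taylorSeries, PowerSeries.coeff_mk]
  rw [iteratedDeriv_fun_mul hf.contDiffAt hg.contDiffAt, Finset.sum_div]
  refine Finset.sum_congr rfl fun i hi => ?_
  have hi : i ≤ k := by simpa [Nat.lt_succ_iff] using hi
  rw [Nat.cast_choose ℂ hi]
  have h1 : (i.factorial : ℂ) ≠ 0 := by exact_mod_cast i.factorial_ne_zero
  have h2 : ((k - i).factorial : ℂ) ≠ 0 := by exact_mod_cast (k - i).factorial_ne_zero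
  have h3 : (k.factorial : ℂ) ≠ 0 := by exact_mod_cast k.factorial_ne_zero
  field_simp

theorem taylorSeries_pow {f : ℂ → ℂ} (hf : AnalyticAt ℂ f 0) (n : ℕ) :
    taylorSeries (fun z => f z ^ n) = taylorSeries f ^ n := by
  induction n with
  | zero => simpa using taylorSeries_const 1
  | succ n ih =>
    simp only [pow_succ]
    rw [taylorSeries_mul (hf.fun_pow n) hf, ih]

theorem constantCoeff_taylorSeries (f : ℂ → ℂ) :
    PowerSeries.constantCoeff (taylorSeries f) = f 0 := by
  simp [taylorSeries, ← PowerSeries.coeff_zero_eq_constantCoeff_apply]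

theorem hasSubst_taylorSeries {g : ℂ → ℂ} (h0 : g 0 = 0) :
    PowerSeries.HasSubst (taylorSeries g) :=
  PowerSeries.HasSubst.of_constantCoeff_zero' (by rw [constantCoeff_taylorSeries, h0])

theorem _root_.AnalyticAt.dslope_self {f : ℂ → ℂ} {z : ℂ} (hf : AnalyticAt ℂ f z) :
    AnalyticAt ℂ (dslope f z) z := by
  obtain ⟨p, hp⟩ := hf
  exact hp.has_fpower_series_dslope_fslope.analyticAt

open PowerSeries in
/-- The Taylor series of a composition is obtained by substitution. -/
theorem taylorSeries_comp {f g : ℂ → ℂ} (hf : AnalyticAt ℂ f 0) (hg : AnalyticAt ℂ g 0)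
    (h0 : g 0 = 0) : taylorSeries (fun z => f (g z)) =
      PowerSeries.substAlgHom (R := ℂ) (hasSubst_taylorSeries h0) (taylorSeries f) := by
  set σ : PowerSeries ℂ →ₐ[ℂ] PowerSeries ℂ :=
    PowerSeries.substAlgHom (R := ℂ) (hasSubst_taylorSeries h0) with hσ
  have hσX : σ X = taylorSeries g := PowerSeries.substAlgHom_X _
  -- The claim is general in `f` because the induction passes from `f` to its slope: $f=f(0)+z\tilde
  -- f$ gives $f\circ g=f(0)+g\cdot(\tilde f\circ g)$, and $g$ vanishes at $0$.
  suffices H : ∀ (N : ℕ) (f : ℂ → ℂ), AnalyticAt ℂ f 0 →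
      X ^ N ∣ taylorSeries (fun z => f (g z)) - σ (taylorSeries f) from
    sub_eq_zero.1 (eq_zero_of_forall_X_pow_dvd fun N => H N f hf)
  intro N
  induction N with
  | zero => simp
  | succ N ih =>
    intro f hf
    have hd := hf.dslope_self
    have hdg : AnalyticAt ℂ (fun z => dslope f 0 (g z)) 0 :=
      AnalyticAt.fun_comp (by rwa [h0]) hg
    have ef : f = fun z => f 0 + z * dslope f 0 z := by
      ext z
      have := sub_smul_dslope f 0 z
      rw [sub_zero, smul_eq_mul] at this
      rw [this]; ring
    have hid : AnalyticAt ℂ (fun z : ℂ => z) 0 := analyticAt_id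
    have e1 : taylorSeries f = C (f 0) + X * taylorSeries (dslope f 0) := by
      conv_lhs => rw [ef]
      rw [taylorSeries_add analyticAt_const (hid.fun_mul hd), taylorSeries_const,
        taylorSeries_mul hid hd, taylorSeries_id]
    have e2 : taylorSeries (fun z => f (g z)) =
        C (f 0) + taylorSeries g * taylorSeries (fun z => dslope f 0 (g z)) := by
      have : (fun z => f (g z)) = fun z => f 0 + g z * dslope f 0 (g z) := by
        ext z; exact congrFun ef (g z)
      rw [this, taylorSeries_add analyticAt_const (hg.fun_mul hdg), taylorSeries_const,
        taylorSeries_mul hg hdg]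
    have e3 : σ (C (f 0)) = C (f 0) := σ.commutes _
    rw [e2, e1, map_add, map_mul, hσX, e3, add_sub_add_left_eq_sub, ← mul_sub, pow_succ']
    refine mul_dvd_mul (X_dvd_iff.2 ?_) (ih _ hd)
    rw [constantCoeff_taylorSeries, h0]

/-! ### Jets of functions tending to `1` -/

section Jet

/-- `F(z) = 1 + β z^j + o(z^j)` as `z → 0`, `z ≠ 0`. -/
def HasJet (j : ℕ) (β : ℂ) (F : ℂ → ℂ) : Prop :=
  Tendsto (fun z => (F z - 1) / z ^ j) (𝓝[≠] 0) (𝓝 β)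

theorem eventually_ne_zero : ∀ᶠ z : ℂ in 𝓝[≠] 0, z ≠ 0 := self_mem_nhdsWithin

theorem tendsto_pow_nhdsNE_zero {j : ℕ} (hj : 1 ≤ j) :
    Tendsto (fun z : ℂ => z ^ j) (𝓝[≠] 0) (𝓝 0) := by
  have : Tendsto (fun z : ℂ => z ^ j) (𝓝 0) (𝓝 (0 ^ j)) := (continuous_pow j).tendsto 0
  rw [zero_pow (by omega)] at this
  exact this.mono_left nhdsWithin_le_nhds

variable {j : ℕ} {β γ : ℂ} {F H : ℂ → ℂ}

theorem HasJet.congr (hF : HasJet j β F) (h : F =ᶠ[𝓝[≠] 0] H) : HasJet j β H :=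
  Tendsto.congr' (h.mono fun z hz => by rw [hz]) hF

theorem HasJet.tendsto_one (hj : 1 ≤ j) (hF : HasJet j β F) : Tendsto F (𝓝[≠] 0) (𝓝 1) := by
  have := (hF.mul (tendsto_pow_nhdsNE_zero hj)).add_const 1
  rw [mul_zero, zero_add] at this
  refine this.congr' (eventually_ne_zero.mono fun z hz => ?_)
  have : z ^ j ≠ 0 := pow_ne_zero _ hz
  field_simp
  ring

theorem hasJet_one : HasJet j 0 (fun _ => 1) := by
  simp [HasJet]

theorem HasJet.mul (hj : 1 ≤ j) (hF : HasJet j β F) (hH : HasJet j γ H) :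
    HasJet j (β + γ) (fun z => F z * H z) := by
  have := (Tendsto.mul hF (hH.tendsto_one hj)).add hH
  rw [mul_one] at this
  refine this.congr fun z => ?_
  ring

theorem HasJet.inv (hj : 1 ≤ j) (hF : HasJet j β F) : HasJet j (-β) (fun z => (F z)⁻¹) := by
  have h1 := hF.tendsto_one hj
  have := (Tendsto.div hF h1 one_ne_zero).neg
  rw [div_one] at this
  refine this.congr' ((h1.eventually_ne one_ne_zero).mono fun z hz => ?_)
  simp only [Pi.div_apply]
  field_simp
  ring

theorem HasJet.pow (hj : 1 ≤ j) (hF : HasJet j β F) (n : ℕ) :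
    HasJet j (n * β) (fun z => F z ^ n) := by
  induction n with
  | zero => simpa using hasJet_one
  | succ n ih =>
    have := ih.mul hj hF
    simp only [pow_succ]
    convert this using 1
    push_cast; ring

theorem HasJet.zpow (hj : 1 ≤ j) (hF : HasJet j β F) (n : ℤ) :
    HasJet j (n * β) (fun z => F z ^ n) := by
  obtain ⟨n, rfl | rfl⟩ := n.eq_nat_or_neg
  · simpa using hF.pow hj n
  · simpa using (hF.pow hj n).inv hj

/-- Leading terms of a relation `z^e A(z) + B(z) = 0`. -/
theorem leading_terms {e : ℤ} {A B : ℂ → ℂ} {α β : ℂ} (hA : Tendsto A (𝓝[≠] 0) (𝓝 α))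
    (hB : Tendsto B (𝓝[≠] 0) (𝓝 β)) (h : ∀ᶠ z in 𝓝[≠] 0, z ^ e * A z + B z = 0) :
    (0 < e → β = 0) ∧ (e = 0 → α + β = 0) ∧ (e < 0 → α = 0) := by
  refine ⟨fun he => ?_, fun he => ?_, fun he => ?_⟩
  · obtain ⟨n, rfl⟩ := Int.eq_ofNat_of_zero_le he.le
    have h1 := ((tendsto_pow_nhdsNE_zero (j := n) (by omega)).mul hA).add hB
    rw [zero_mul, zero_add] at h1
    refine tendsto_nhds_unique h1 (tendsto_const_nhds.congr' (h.mono fun z hz => ?_))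
    simpa using hz.symm
  · subst he
    refine tendsto_nhds_unique (hA.add hB) (tendsto_const_nhds.congr' (h.mono fun z hz => ?_))
    simpa using hz.symm
  · obtain ⟨n, hn⟩ := Int.eq_ofNat_of_zero_le (neg_nonneg.2 he.le)
    obtain rfl : e = -(n : ℤ) := by omega
    have h1 := hA.add ((tendsto_pow_nhdsNE_zero (j := n) (by omega)).mul hB)
    rw [zero_mul, add_zero] at h1
    refine tendsto_nhds_unique h1 (tendsto_const_nhds.congr'
      ((h.and eventually_ne_zero).mono fun z hz => ?_))
    have h2 : z ^ n ≠ 0 := pow_ne_zero _ hz.2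
    have h3 := hz.1
    rw [zpow_neg, zpow_natCast] at h3
    field_simp at h3
    exact (mul_zero (z ^ n)).symm.trans h3.symm

end Jet

/-! ### Germs tangent to the identity -/

section Tangent

/-- This shape is stable under differentiation, so it can be applied three times to $z+z^{j+1}u$.
The exponent is an integer since it reaches $-1$ when $j=1$. -/
theorem exists_deriv_eq {f u : ℂ → ℂ} {c d : ℂ} {k : ℤ} (hu : AnalyticAt ℂ u 0)
    (hf : f =ᶠ[𝓝[≠] 0] fun z => c + d * z + z ^ k * u z) :
    ∃ u' : ℂ → ℂ, AnalyticAt ℂ u' 0 ∧ u' 0 = k * u 0 ∧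
      deriv f =ᶠ[𝓝[≠] 0] fun z => d + 0 * z + z ^ (k - 1) * u' z := by
  refine ⟨fun z => k * u z + z * deriv u z, by fun_prop, by simp, ?_⟩
  refine hf.nhdsNE_deriv.trans ?_
  have hu' : ∀ᶠ z in 𝓝[≠] (0 : ℂ), AnalyticAt ℂ u z :=
    hu.eventually_analyticAt.filter_mono nhdsWithin_le_nhds
  filter_upwards [hu', eventually_ne_zero] with z hz hz0
  have h1 : HasDerivAt (fun z => c + d * z + z ^ k * u z)
      (d * 1 + (k * z ^ (k - 1) * u z + z ^ k * deriv u z)) z :=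
    (((hasDerivAt_id' z).const_mul d).const_add c).add
      ((hasDerivAt_zpow k z (Or.inl hz0)).mul hz.differentiableAt.hasDerivAt)
  rw [h1.deriv, zpow_sub_one₀ hz0]
  field_simp
  ring

/-- The germ at `0` of `f` is `z + z^(j+1) u(z)`, with `u` analytic. -/
structure TangentGerm (j : ℕ) (f u : ℂ → ℂ) : Prop where
  pos : 1 ≤ j
  analyticAt : AnalyticAt ℂ u 0
  eventuallyEq : f =ᶠ[𝓝 0] fun z => z + z ^ (j + 1) * u z

variable {j : ℕ} {f u : ℂ → ℂ}

theorem TangentGerm.eventuallyEq_nhdsNE (h : TangentGerm j f u) :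
    f =ᶠ[𝓝[≠] 0] fun z => z + z ^ (j + 1) * u z :=
  h.eventuallyEq.filter_mono nhdsWithin_le_nhds

theorem TangentGerm.tendsto_nhdsNE (h : TangentGerm j f u) : Tendsto f (𝓝[≠] 0) (𝓝[≠] 0) := by
  have h0 : f 0 = 0 := by rw [h.eventuallyEq.eq_of_nhds]; simp
  have h1 : HasDerivAt (fun z => z + z ^ (j + 1) * u z) 1 0 := by
    have h2 : HasDerivAt (fun z => z + z ^ (j + 1) * u z) _ 0 := (hasDerivAt_id' (0 : ℂ)).add
      ((hasDerivAt_pow (j + 1) (0 : ℂ)).mul h.analyticAt.differentiableAt.hasDerivAt)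
    refine h2.congr_deriv ?_
    have := h.pos
    simp [show j ≠ 0 by omega]
  have := (h1.congr_of_eventuallyEq h.eventuallyEq).tendsto_nhdsNE one_ne_zero
  rwa [h0] at this

theorem TangentGerm.hasJet_div (h : TangentGerm j f u) : HasJet j (u 0) (fun z => f z / z) := by
  refine (h.analyticAt.continuousAt.tendsto.mono_left nhdsWithin_le_nhds).congr' ?_
  filter_upwards [h.eventuallyEq_nhdsNE, eventually_ne_zero] with z hz hz0
  rw [hz]
  field_simp
  ring

theorem TangentGerm.exists_derivs (h : TangentGerm j f u) : ∃ u₁ u₂ u₃ : ℂ → ℂ,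
    Tendsto u₁ (𝓝[≠] 0) (𝓝 ((j + 1) * u 0)) ∧ Tendsto u₂ (𝓝[≠] 0) (𝓝 (j * (j + 1) * u 0)) ∧
    Tendsto u₃ (𝓝[≠] 0) (𝓝 ((j - 1) * j * (j + 1) * u 0)) ∧ ∀ᶠ z in 𝓝[≠] 0,
      deriv f z = 1 + z ^ j * u₁ z ∧ z * iteratedDeriv 2 f z = z ^ j * u₂ z ∧
      z ^ 2 * iteratedDeriv 3 f z = z ^ j * u₃ z := by
  have e0 : f =ᶠ[𝓝[≠] 0] fun z => 0 + 1 * z + z ^ ((j : ℤ) + 1) * u z :=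
    h.eventuallyEq_nhdsNE.mono fun z hz => by rw [hz]; norm_cast; ring
  obtain ⟨u₁, a1, v1, e1⟩ := exists_deriv_eq h.analyticAt e0
  obtain ⟨u₂, a2, v2, e2⟩ := exists_deriv_eq a1 e1
  obtain ⟨u₃, a3, v3, e3⟩ := exists_deriv_eq a2 e2
  have t : ∀ {w : ℂ → ℂ} {c : ℂ}, AnalyticAt ℂ w 0 → w 0 = c → Tendsto w (𝓝[≠] 0) (𝓝 c) :=
    fun hw hc => hc ▸ hw.continuousAt.tendsto.mono_left nhdsWithin_le_nhds
  refine ⟨u₁, u₂, u₃, t a1 ?_, t a2 ?_, t a3 ?_, ?_⟩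
  · rw [v1]; push_cast; ring
  · rw [v2, v1]; push_cast; ring
  · rw [v3, v2, v1]; push_cast; ring
  filter_upwards [e1, e2, e3, eventually_ne_zero] with z h1 h2 h3 hz
  simp only [iteratedDeriv_succ, iteratedDeriv_zero]
  rw [h1, h2, h3]
  have hzz : z ^ ((j : ℤ) + 1 - 1) = z ^ j := by simp
  refine ⟨by rw [hzz]; ring, ?_, ?_⟩
  · rw [zpow_sub_one₀ hz, hzz]
    field_simp
    ring
  · rw [zpow_sub_one₀ hz, zpow_sub_one₀ hz, hzz]
    field_simp
    ring

theorem TangentGerm.hasJet_deriv (h : TangentGerm j f u) : HasJet j ((j + 1) * u 0) (deriv f) := by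
  obtain ⟨u₁, u₂, u₃, t, -, -, e⟩ := h.exists_derivs
  refine t.congr' ((e.and eventually_ne_zero).mono fun z hz => ?_)
  have : z ^ j ≠ 0 := pow_ne_zero _ hz.2
  simp only [hz.1.1]
  field_simp
  ring

/-- As $f(z)-z=O(z^{j+1})$ and $v$ is Lipschitz near $0$, an analytic unit contributes nothing at
order $j$. -/
theorem TangentGerm.hasJet_comp_div (h : TangentGerm j f u) {v : ℂ → ℂ} (hv : AnalyticAt ℂ v 0)
    (hv0 : v 0 ≠ 0) : HasJet j 0 (fun z => v (f z) / v z) := by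
  have tv : Tendsto v (𝓝[≠] 0) (𝓝 (v 0)) :=
    hv.continuousAt.tendsto.mono_left nhdsWithin_le_nhds
  have hO : (fun z => v (f z) - v z) =O[𝓝[≠] 0] fun z => f z - z := by
    have h1 := (hv.hasStrictDerivAt.hasStrictFDerivAt).isBigO_sub
    have h2 : Tendsto (fun z : ℂ => (f z, z)) (𝓝[≠] 0) (𝓝 (0, 0)) :=
      (h.tendsto_nhdsNE.mono_right nhdsWithin_le_nhds).prodMk_nhds nhdsWithin_le_nhds
    exact h1.comp_tendsto h2
  have ho : (fun z => f z - z) =o[𝓝[≠] 0] fun z => z ^ j := by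
    refine (Asymptotics.isLittleO_iff_tendsto' (eventually_ne_zero.mono fun z hz h => ?_)).2 ?_
    · exact absurd h (pow_ne_zero _ hz)
    · have : Tendsto (fun z => z * u z) (𝓝 0) (𝓝 (0 * u 0)) :=
        tendsto_id.mul h.analyticAt.continuousAt.tendsto
      rw [zero_mul] at this
      refine (this.mono_left nhdsWithin_le_nhds).congr' ?_
      filter_upwards [h.eventuallyEq_nhdsNE, eventually_ne_zero] with z hz hz0
      rw [hz]
      field_simp
      ring
  have := ((hO.trans_isLittleO ho).tendsto_div_nhds_zero.div tv hv0)
  rw [zero_div] at this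
  refine this.congr' ((tv.eventually_ne hv0).mono fun z hz => ?_)
  simp only [Pi.div_apply]
  field_simp

/-- The function is $(f/z)^k\cdot(v\circ f/v)\cdot(f')^n$, and the jets $k\,u(0)$, $0$ and
$n(j+1)u(0)$ of the factors add up. Every order computation below rests on this. -/
theorem TangentGerm.hasJet_meromorphic (h : TangentGerm j f u) {w v : ℂ → ℂ} {k : ℤ}
    (hv : AnalyticAt ℂ v 0) (hv0 : v 0 ≠ 0) (hw : ∀ᶠ z in 𝓝[≠] 0, w z = z ^ k * v z) (n : ℤ) :
    HasJet j ((k + n * (j + 1)) * u 0) (fun z => w (f z) / w z * deriv f z ^ n) := by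
  have := ((h.hasJet_div.zpow h.pos k).mul h.pos (h.hasJet_comp_div hv hv0)).mul h.pos
    (h.hasJet_deriv.zpow h.pos n)
  rw [show (k + n * (j + 1)) * u 0 = k * u 0 + 0 + n * ((j + 1) * u 0) by ring]
  refine this.congr ?_
  filter_upwards [hw, h.tendsto_nhdsNE.eventually hw] with z h1 h2
  rw [h1, h2, div_zpow, mul_div_mul_comm]

end Tangent

/-! ### The order of contact of the solutions of a D-groupoid -/

section Contact

variable {j : ℕ} {f u : ℂ → ℂ}

theorem _root_.MeromorphicAt.eventually_eq_zero_or_exists_eq_zpow_mul {w : ℂ → ℂ}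
    (hw : MeromorphicAt w 0) : (∀ᶠ z in 𝓝[≠] 0, w z = 0) ∨ ∃ (k : ℤ) (v : ℂ → ℂ),
      AnalyticAt ℂ v 0 ∧ v 0 ≠ 0 ∧ ∀ᶠ z in 𝓝[≠] 0, w z = z ^ k * v z := by
  by_cases h : meromorphicOrderAt w 0 = ⊤
  · exact Or.inl (meromorphicOrderAt_eq_top_iff.1 h)
  · obtain ⟨v, hv, hv0, e⟩ := (meromorphicOrderAt_ne_top_iff hw).1 h
    exact Or.inr ⟨_, v, hv, hv0, by simpa [EventuallyEq] using e⟩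

theorem TangentGerm.order_eq_of_invariant_form (h : TangentGerm j f u) (hu : u 0 ≠ 0)
    {w v : ℂ → ℂ} {k : ℤ} (hv : AnalyticAt ℂ v 0) (hv0 : v 0 ≠ 0)
    (hw : ∀ᶠ z in 𝓝[≠] 0, w z = z ^ k * v z) {n : ℤ}
    (he : ∀ᶠ z in 𝓝[≠] 0, w (f z) * deriv f z ^ n - w z = 0) : k + n * (j + 1) = 0 := by
  have tv : ∀ᶠ z in 𝓝[≠] 0, v z ≠ 0 :=
    (hv.continuousAt.eventually_ne hv0).filter_mono nhdsWithin_le_nhds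
  have h1 : HasJet j 0 (fun z => w (f z) / w z * deriv f z ^ n) := by
    refine hasJet_one.congr ?_
    filter_upwards [hw, he, tv, eventually_ne_zero] with z h1 h2 h3 h4
    have : w z ≠ 0 := by rw [h1]; exact mul_ne_zero (zpow_ne_zero _ h4) h3
    rw [div_mul_eq_mul_div, sub_eq_zero.1 h2, div_self this]
  have h2 := tendsto_nhds_unique (h.hasJet_meromorphic hv hv0 hw n) h1
  have h3 := (mul_eq_zero.1 h2).resolve_right hu
  exact_mod_cast h3

/-- A nonzero invariant function has order $0$ by the case $n=0$ above. Subtracting its value at $0$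
leaves an invariant function tending to $0$, so the difference vanishes identically near $0$. -/
theorem TangentGerm.false_of_invariant_function (h : TangentGerm j f u) (hu : u 0 ≠ 0)
    {w : ℂ → ℂ} (hw : MeromorphicAt w 0) (hc : ∀ c, ¬ ∀ᶠ z in 𝓝[≠] 0, w z = c)
    (he : ∀ᶠ z in 𝓝[≠] 0, w (f z) = w z) : False := by
  obtain h0 | ⟨k, v, hv, hv0, e⟩ := hw.eventually_eq_zero_or_exists_eq_zpow_mul
  · exact hc 0 h0
  obtain rfl : k = 0 := by
    have := h.order_eq_of_invariant_form hu hv hv0 e (n := 0)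
      (he.mono fun z hz => by rw [hz]; simp)
    simpa using this
  have hw' : MeromorphicAt (fun z => w z - v 0) 0 := hw.sub (MeromorphicAt.const _ _)
  obtain h0 | ⟨k', v', hv', hv0', e'⟩ := hw'.eventually_eq_zero_or_exists_eq_zpow_mul
  · exact hc (v 0) (h0.mono fun z hz => sub_eq_zero.1 hz)
  obtain rfl : k' = 0 := by
    have := h.order_eq_of_invariant_form hu hv' hv0' e' (n := 0)
      (he.mono fun z hz => by rw [hz]; simp)
    simpa using this
  have t : Tendsto v' (𝓝[≠] 0) (𝓝 (v' 0)) :=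
    hv'.continuousAt.tendsto.mono_left nhdsWithin_le_nhds
  have t' : Tendsto (fun z => v z - v 0) (𝓝[≠] 0) (𝓝 (v 0 - v 0)) :=
    (hv.continuousAt.tendsto.mono_left nhdsWithin_le_nhds).sub_const _
  rw [sub_self] at t'
  refine hv0' (tendsto_nhds_unique t (t'.congr' ?_))
  filter_upwards [e, e'] with z h1 h2
  rw [h1] at h2
  simpa using h2

/-- Multiplied by $z/z^j$, the equation becomes $z^{k+1}A+B=0$ with $A\to v(0)(k+j+1)u(0)$ and $B\to
j(j+1)u(0)\ne 0$. The sign of $k+1$ decides which term dominates. -/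
theorem TangentGerm.order_of_affine_connection (h : TangentGerm j f u) (hu : u 0 ≠ 0)
    {w v : ℂ → ℂ} {k : ℤ} (hv : AnalyticAt ℂ v 0) (hv0 : v 0 ≠ 0)
    (hw : ∀ᶠ z in 𝓝[≠] 0, w z = z ^ k * v z)
    (he : ∀ᶠ z in 𝓝[≠] 0, w (f z) * deriv f z + iteratedDeriv 2 f z / deriv f z - w z = 0) :
    (k = -1 ∧ v 0 = -(j + 1)) ∨ (k < -1 ∧ k = -(j + 1)) := by
  obtain ⟨u₁, u₂, u₃, -, t, -, e⟩ := h.exists_derivs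
  have hj := h.pos
  have tv : Tendsto v (𝓝[≠] 0) (𝓝 (v 0)) :=
    hv.continuousAt.tendsto.mono_left nhdsWithin_le_nhds
  have td := h.hasJet_deriv.tendsto_one h.pos
  have hjet := h.hasJet_meromorphic hv hv0 hw 1
  have hA := tv.mul hjet
  have hB := t.div td one_ne_zero
  obtain ⟨c1, c2, c3⟩ := leading_terms (e := k + 1) hA hB (by
    filter_upwards [hw, he, e, eventually_ne_zero, tv.eventually_ne hv0,
      td.eventually_ne one_ne_zero] with z h1 h2 h3 h4 h5 h6
    have hz : z ^ j ≠ 0 := pow_ne_zero _ h4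
    have hzk : z ^ k ≠ 0 := zpow_ne_zero _ h4
    have h7 : u₂ z = z * iteratedDeriv 2 f z / z ^ j := by
      rw [h3.2.1]; field_simp
    rw [h1] at h2 ⊢
    simp only [Pi.div_apply]
    rw [h7, zpow_one, zpow_add_one₀ h4]
    have : (z ^ k * z * (v z * ((w (f z) / (z ^ k * v z) * deriv f z - 1) / z ^ j)) +
        z * iteratedDeriv 2 f z / z ^ j / deriv f z) =
        z / z ^ j * (w (f z) * deriv f z + iteratedDeriv 2 f z / deriv f z - z ^ k * v z) := by
      field_simp
      ring
    rw [this, h2, mul_zero])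
  have hjc : (j : ℂ) ≠ 0 := by exact_mod_cast (by omega : j ≠ 0)
  have hjc1 : (j : ℂ) + 1 ≠ 0 := by exact_mod_cast (by omega : j + 1 ≠ 0)
  rcases lt_trichotomy (k + 1) 0 with hk | hk | hk
  · right
    have := c3 hk
    rw [mul_eq_zero, mul_eq_zero] at this
    have := (this.resolve_left hv0).resolve_right hu
    have : k + 1 * ((j : ℤ) + 1) = 0 := by exact_mod_cast this
    omega
  · left
    have hk' : k = -1 := by omega
    subst hk'
    refine ⟨rfl, ?_⟩
    have := c2 hk
    refine mul_left_cancel₀ (mul_ne_zero hjc hu) ?_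
    push_cast at this
    linear_combination this
  · have := c1 hk
    simp [hjc, hjc1, hu] at this

theorem TangentGerm.false_of_flat_affine_connection (h : TangentGerm j f u) (hu : u 0 ≠ 0)
    {w : ℂ → ℂ} (hw : ∀ᶠ z in 𝓝[≠] 0, w z = 0)
    (he : ∀ᶠ z in 𝓝[≠] 0, w (f z) * deriv f z + iteratedDeriv 2 f z / deriv f z - w z = 0) :
    False := by
  obtain ⟨u₁, u₂, u₃, -, t, -, e⟩ := h.exists_derivs
  have hj := h.pos
  have td := h.hasJet_deriv.tendsto_one h.pos
  have hjc : (j : ℂ) ≠ 0 := by exact_mod_cast (by omega : j ≠ 0)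
  have hjc1 : (j : ℂ) + 1 ≠ 0 := by exact_mod_cast (by omega : j + 1 ≠ 0)
  have h0 : ∀ᶠ z in 𝓝[≠] 0, 0 = u₂ z := by
    filter_upwards [hw, h.tendsto_nhdsNE.eventually hw, he, e, eventually_ne_zero,
      td.eventually_ne one_ne_zero] with z h1 h2 h3 h4 h5 h6
    have hz : z ^ j ≠ 0 := pow_ne_zero _ h5
    rw [h1, h2] at h3
    have h7 : iteratedDeriv 2 f z = 0 := by simpa [h6] using h3
    have := h4.2.1
    rw [h7, mul_zero] at this
    exact ((mul_eq_zero.1 this.symm).resolve_left hz).symm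
  have := tendsto_nhds_unique t (tendsto_const_nhds.congr' h0)
  simp [hjc, hjc1, hu] at this

/-- The squared term is $O(z^{2j-2})$, negligible against $z^{j-2}$. The limit vanishes for $j=1$,
as it must: Möbius maps have zero Schwarzian derivative. -/
theorem TangentGerm.tendsto_schwarzian (h : TangentGerm j f u) :
    Tendsto (fun z => z ^ 2 / z ^ j * (2 * (iteratedDeriv 3 f z / deriv f z)
      - 3 * (iteratedDeriv 2 f z / deriv f z) ^ 2)) (𝓝[≠] 0)
      (𝓝 (2 * ((j - 1) * j * (j + 1) * u 0))) := by
  obtain ⟨u₁, u₂, u₃, -, t2, t3, e⟩ := h.exists_derivs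
  have td := h.hasJet_deriv.tendsto_one h.pos
  have := ((t3.div td one_ne_zero).const_mul 2).sub
    (((tendsto_pow_nhdsNE_zero h.pos).mul ((t2.div td one_ne_zero).pow 2)).const_mul 3)
  rw [zero_mul, mul_zero, sub_zero, div_one] at this
  refine this.congr' ?_
  filter_upwards [e, eventually_ne_zero, td.eventually_ne one_ne_zero] with z h1 h2 h3
  have hz : z ^ j ≠ 0 := pow_ne_zero _ h2
  have e2 : iteratedDeriv 2 f z = z ^ j * u₂ z / z := by rw [← h1.2.1]; field_simp
  have e3 : iteratedDeriv 3 f z = z ^ j * u₃ z / z ^ 2 := by rw [← h1.2.2]; field_simp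
  simp only [Pi.div_apply]
  rw [e2, e3]
  field_simp

/-- Multiplication by $z^2/z^j$ gives $z^{k+2}A+B=0$ with $A\to v(0)(k+2j+2)u(0)$ and $B\to
2(j-1)j(j+1)u(0)$. -/
theorem TangentGerm.order_of_projective_connection (h : TangentGerm j f u) (hu : u 0 ≠ 0)
    {w v : ℂ → ℂ} {k : ℤ} (hv : AnalyticAt ℂ v 0) (hv0 : v 0 ≠ 0)
    (hw : ∀ᶠ z in 𝓝[≠] 0, w z = z ^ k * v z)
    (he : ∀ᶠ z in 𝓝[≠] 0, w (f z) * deriv f z ^ 2 + 2 * (iteratedDeriv 3 f z / deriv f z)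
        - 3 * (iteratedDeriv 2 f z / deriv f z) ^ 2 - w z = 0) :
    (-2 < k ∧ j = 1) ∨ (k = -2 ∧ v 0 = 1 - j ^ 2) ∨ (k < -2 ∧ k = -2 * (j + 1)) := by
  have hj := h.pos
  have tv : Tendsto v (𝓝[≠] 0) (𝓝 (v 0)) :=
    hv.continuousAt.tendsto.mono_left nhdsWithin_le_nhds
  have hjet := h.hasJet_meromorphic hv hv0 hw 2
  obtain ⟨c1, c2, c3⟩ := leading_terms (e := k + 2) (tv.mul hjet) h.tendsto_schwarzian (by
    filter_upwards [hw, he, eventually_ne_zero, tv.eventually_ne hv0] with z h1 h2 h4 h5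
    have hz : z ^ j ≠ 0 := pow_ne_zero _ h4
    have hzk : z ^ k ≠ 0 := zpow_ne_zero _ h4
    rw [h1] at h2 ⊢
    have hd : deriv f z ^ (2 : ℤ) = deriv f z ^ 2 := by norm_cast
    rw [hd, zpow_add₀ h4, show z ^ (2 : ℤ) = z ^ 2 by norm_cast]
    have : z ^ k * z ^ 2 * (v z * ((w (f z) / (z ^ k * v z) * deriv f z ^ 2 - 1) / z ^ j)) =
        z ^ 2 / z ^ j * (w (f z) * deriv f z ^ 2 - z ^ k * v z) := by
      field_simp
    rw [this]
    linear_combination z ^ 2 / z ^ j * h2)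
  have hjc : (j : ℂ) ≠ 0 := by exact_mod_cast (by omega : j ≠ 0)
  have hjc1 : (j : ℂ) + 1 ≠ 0 := by exact_mod_cast (by omega : j + 1 ≠ 0)
  rcases lt_trichotomy (k + 2) 0 with hk | hk | hk
  · right; right
    have := c3 hk
    rw [mul_eq_zero, mul_eq_zero] at this
    have := (this.resolve_left hv0).resolve_right hu
    have : k + 2 * ((j : ℤ) + 1) = 0 := by exact_mod_cast this
    omega
  · right; left
    have hk' : k = -2 := by omega
    subst hk'
    refine ⟨rfl, ?_⟩
    have := c2 hk
    refine mul_left_cancel₀ (mul_ne_zero (mul_ne_zero two_ne_zero hjc) hu) ?_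
    push_cast at this
    linear_combination this
  · left
    have := c1 hk
    simp only [mul_eq_zero, hjc, hjc1, hu, or_false, OfNat.ofNat_ne_zero, false_or] at this
    have : (j : ℂ) = 1 := by linear_combination this
    have : j = 1 := by exact_mod_cast this
    omega

theorem TangentGerm.order_of_flat_projective_connection (h : TangentGerm j f u) (hu : u 0 ≠ 0)
    {w : ℂ → ℂ} (hw : ∀ᶠ z in 𝓝[≠] 0, w z = 0)
    (he : ∀ᶠ z in 𝓝[≠] 0, w (f z) * deriv f z ^ 2 + 2 * (iteratedDeriv 3 f z / deriv f z)
        - 3 * (iteratedDeriv 2 f z / deriv f z) ^ 2 - w z = 0) : j = 1 := by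
  have hj := h.pos
  have h0 : ∀ᶠ z in 𝓝[≠] 0, 0 = z ^ 2 / z ^ j * (2 * (iteratedDeriv 3 f z / deriv f z)
      - 3 * (iteratedDeriv 2 f z / deriv f z) ^ 2) := by
    filter_upwards [hw, h.tendsto_nhdsNE.eventually hw, he] with z h1 h2 h3
    rw [h1, h2] at h3
    linear_combination -(z ^ 2 / z ^ j * h3)
  have := tendsto_nhds_unique h.tendsto_schwarzian (tendsto_const_nhds.congr' h0)
  have hjc : (j : ℂ) ≠ 0 := by exact_mod_cast (by omega : j ≠ 0)
  have hjc1 : (j : ℂ) + 1 ≠ 0 := by exact_mod_cast (by omega : j + 1 ≠ 0)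
  simp only [mul_eq_zero, hjc, hjc1, hu, or_false, OfNat.ofNat_ne_zero, false_or] at this
  have : (j : ℂ) = 1 := by linear_combination this
  exact_mod_cast this

/-- Identity principle on the connected disc. It shows that degenerate equations, whose coefficient
is constant near $0$, hold on all of $\mathrm{Aut}(\Delta)$ and so are excluded by properness. -/
theorem eventually_eq_const_of_mem_ball {r : ℝ} {η : ℂ → ℂ}
    (hη : MeromorphicOn η (Metric.ball 0 r)) {c : ℂ} (h : ∀ᶠ z in 𝓝[≠] 0, η z = c) {x : ℂ}
    (hx : x ∈ Metric.ball (0 : ℂ) r) : ∀ᶠ z in 𝓝[≠] x, η z = c := by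
  have hr : (0 : ℂ) ∈ Metric.ball (0 : ℂ) r := by
    rw [Metric.mem_ball, dist_self]; exact dist_nonneg.trans_lt (Metric.mem_ball.1 hx)
  have hm : MeromorphicOn (fun z => η z - c) (Metric.ball 0 r) :=
    fun z hz => (hη z hz).sub (MeromorphicAt.const _ _)
  have h0 : meromorphicOrderAt (fun z => η z - c) 0 = ⊤ :=
    meromorphicOrderAt_eq_top_iff.2 (h.mono fun z hz => sub_eq_zero.2 hz)
  have hxt : meromorphicOrderAt (fun z => η z - c) x = ⊤ := by
    by_contra hne
    exact hm.meromorphicOrderAt_ne_top_of_isPreconnected (convex_ball _ _).isPreconnected hx hr hne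
      h0
  exact (meromorphicOrderAt_eq_top_iff.1 hxt).mono fun z hz => sub_eq_zero.1 hz

theorem autDisc.eventually_eq_const {r : ℝ} {η : ℂ → ℂ}
    (hη : MeromorphicOn η (Metric.ball 0 r)) {c : ℂ} (h : ∀ᶠ z in 𝓝[≠] 0, η z = c)
    {p : ℂ × (ℂ → ℂ)} (hp : p ∈ autDisc r) :
    ∀ᶠ z in 𝓝[≠] p.1, η z = c ∧ η (p.2 z) = c := by
  obtain ⟨h1, h2, h3, h4⟩ := hp
  exact (eventually_eq_const_of_mem_ball hη h h1).and
    ((h2.differentiableAt.hasDerivAt.tendsto_nhdsNE h4).eventually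
      (eventually_eq_const_of_mem_ball hη h h3))

/-- All the solutions of a proper D-groupoid that are tangent to the identity at `0`, other than
the identity, have the same order of contact with the identity. -/
theorem DGroupoid.contact_order_unique {r : ℝ} (hr : 0 < r) {D : DGroupoid r}
    (hD : ¬ autDisc r ⊆ D.sol) {j₁ j₂ : ℕ} {f₁ f₂ u₁ u₂ : ℂ → ℂ} (h₁ : TangentGerm j₁ f₁ u₁)
    (h₂ : TangentGerm j₂ f₂ u₂) (hu₁ : u₁ 0 ≠ 0) (hu₂ : u₂ 0 ≠ 0)
    (e₁ : ∀ᶠ z in 𝓝[≠] 0, D.Equation f₁ z) (e₂ : ∀ᶠ z in 𝓝[≠] 0, D.Equation f₂ z) : j₁ = j₂ := by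
  have hmem : (0 : ℂ) ∈ Metric.ball (0 : ℂ) r := Metric.mem_ball_self hr
  cases D with
  | order0 η hη =>
    have hη : MeromorphicOn η (Metric.ball 0 r) :=
      fun z hz => (hη.analyticAt (Metric.isOpen_ball.mem_nhds hz)).meromorphicAt
    exfalso
    refine h₁.false_of_invariant_function hu₁ (hη 0 hmem) (fun c hc => hD fun p hp => ⟨hp, ?_⟩)
      (e₁.mono fun z hz => (sub_eq_zero.1 hz).symm)
    refine (autDisc.eventually_eq_const hη hc hp).mono fun z hz => ?_
    rw [DGroupoid.Equation, hz.1, hz.2, sub_self]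
  | order1 n η hη =>
    -- For $n=0$ the equation only says that `η` is an invariant function, as in order zero.
    by_cases hn : n = 0
    · subst hn
      exfalso
      refine h₁.false_of_invariant_function hu₁ (hη 0 hmem) (fun c hc => hD fun p hp => ⟨hp, ?_⟩)
        (e₁.mono fun z hz => ?_)
      · refine (autDisc.eventually_eq_const hη hc hp).mono fun z hz => ?_
        rw [DGroupoid.Equation, hz.1, hz.2, zpow_zero, mul_one, sub_self]
      · rw [DGroupoid.Equation, zpow_zero, mul_one] at hz
        exact sub_eq_zero.1 hz
    · obtain h0 | ⟨k, v, hv, hv0, e⟩ := (hη 0 hmem).eventually_eq_zero_or_exists_eq_zpow_mul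
      · refine absurd (fun p hp => ⟨hp, ?_⟩) hD
        refine (autDisc.eventually_eq_const hη h0 hp).mono fun z hz => ?_
        rw [DGroupoid.Equation, hz.1, hz.2, zero_mul, sub_self]
      · have a1 := h₁.order_eq_of_invariant_form hu₁ hv hv0 e e₁
        have a2 := h₂.order_eq_of_invariant_form hu₂ hv hv0 e e₂
        have : n * ((j₁ : ℤ) + 1) = n * ((j₂ : ℤ) + 1) := by linear_combination a1 - a2
        have := mul_left_cancel₀ hn this
        omega
  | order2 μ hμ =>
    obtain h0 | ⟨k, v, hv, hv0, e⟩ := (hμ 0 hmem).eventually_eq_zero_or_exists_eq_zpow_mul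
    · exact (h₁.false_of_flat_affine_connection hu₁ h0 e₁).elim
    · obtain ⟨a1, b1⟩ | ⟨a1, b1⟩ := h₁.order_of_affine_connection hu₁ hv hv0 e e₁ <;>
      obtain ⟨a2, b2⟩ | ⟨a2, b2⟩ := h₂.order_of_affine_connection hu₂ hv hv0 e e₂
      · rw [b1] at b2
        have : (j₁ : ℂ) = j₂ := by linear_combination -b2
        exact_mod_cast this
      all_goals omega
  | order3 ν hν =>
    obtain h0 | ⟨k, v, hv, hv0, e⟩ := (hν 0 hmem).eventually_eq_zero_or_exists_eq_zpow_mul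
    · rw [h₁.order_of_flat_projective_connection hu₁ h0 e₁,
        h₂.order_of_flat_projective_connection hu₂ h0 e₂]
    · obtain ⟨a1, b1⟩ | ⟨a1, b1⟩ | ⟨a1, b1⟩ :=
        h₁.order_of_projective_connection hu₁ hv hv0 e e₁ <;>
      obtain ⟨a2, b2⟩ | ⟨a2, b2⟩ | ⟨a2, b2⟩ :=
        h₂.order_of_projective_connection hu₂ hv hv0 e e₂
      -- Both germs see the same `k` and `v 0`, so mixed cases clash. Otherwise $j$ is $1$, is read
      -- off `k`, or comes from $v(0)=1-j^2$.
      all_goals first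
        | omega
        | rw [b1] at b2
          have : (j₁ : ℂ) ^ 2 = j₂ ^ 2 := by linear_combination -b2
          have : j₁ ^ 2 = j₂ ^ 2 := by exact_mod_cast this
          exact Nat.pow_left_injective two_ne_zero this
  | infinite => exact absurd (fun p hp => ⟨hp, Eventually.of_forall fun _ => rfl⟩) hD

end Contact

/-! ### Germs of diffeomorphisms -/

section Germs

theorem Diff.analyticAt_rep (g : Diff) : AnalyticAt ℂ g.rep 0 := MapGerm.rep_analyticAt _

theorem Diff.rep_zero (g : Diff) : g.rep 0 = 0 := MapGerm.rep_zero _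

theorem Diff.rep_mul (g h : Diff) : (g * h).rep =ᶠ[𝓝 0] fun z => g.rep (h.rep z) :=
  MapGerm.rep_mul (g : MapGerm) (h : MapGerm)

theorem Diff.rep_one : Diff.rep 1 =ᶠ[𝓝 0] fun z => z := MapGerm.rep_one

theorem Diff.ext_rep {g h : Diff} (e : g.rep =ᶠ[𝓝 0] h.rep) : g = h :=
  Units.ext (MapGerm.ext_rep e)

theorem Diff.deriv_rep_ne_zero (g : Diff) : deriv g.rep 0 ≠ 0 := by
  intro h
  have := Diff.deriv_rep_mul g g⁻¹
  rw [mul_inv_cancel, Diff.deriv_rep_one, h, zero_mul] at this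
  exact one_ne_zero this

/-- The multiplier `g ↦ g'(0)`. -/
def multiplier : Diff →* ℂˣ :=
  MonoidHom.toHomUnits
    { toFun := fun g => deriv g.rep 0
      map_one' := Diff.deriv_rep_one
      map_mul' := Diff.deriv_rep_mul }

theorem ker_multiplier : multiplier.ker = tangentToId := by
  ext g
  rw [MonoidHom.mem_ker, Units.ext_iff]
  rfl

variable {j : ℕ} {f u v : ℂ → ℂ}

theorem TangentGerm.eq_at_zero (hu : TangentGerm j f u) (hv : TangentGerm j f v) : u 0 = v 0 :=
  tendsto_nhds_unique hu.hasJet_div hv.hasJet_div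

theorem tangentGerm_one (hj : 1 ≤ j) : TangentGerm j (Diff.rep 1) 0 where
  pos := hj
  analyticAt := analyticAt_const
  eventuallyEq := by simpa using Diff.rep_one

/-- Since $h^{j+1}=z^{j+1}(1+z^jv)^{j+1}$ with $j\ge 1$, composition adds leading coefficients. -/
theorem TangentGerm.mul {g h : Diff} (hg : TangentGerm j g.rep u) (hh : TangentGerm j h.rep v) :
    ∃ w, TangentGerm j (g * h).rep w ∧ w 0 = u 0 + v 0 := by
  have hu : AnalyticAt ℂ (fun z => u (h.rep z)) 0 :=
    AnalyticAt.fun_comp (by rw [h.rep_zero]; exact hg.analyticAt) h.analyticAt_rep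
  have hv := hh.analyticAt
  have hj := hg.pos
  refine ⟨fun z => v z + (1 + z ^ j * v z) ^ (j + 1) * u (h.rep z), ⟨hj,
    hv.fun_add (((analyticAt_const.fun_add ((analyticAt_id.fun_pow j).fun_mul hv)).fun_pow _).fun_mul hu),
    ?_⟩, ?_⟩
  · have ht : Tendsto h.rep (𝓝 0) (𝓝 0) := by
      simpa [h.rep_zero] using h.analyticAt_rep.continuousAt.tendsto
    filter_upwards [Diff.rep_mul g h, ht.eventually hg.eventuallyEq, hh.eventuallyEq]
      with z h1 h2 h3
    rw [h1, h2]
    have : h.rep z = z * (1 + z ^ j * v z) := by rw [h3]; ring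
    nth_rw 2 [this]
    rw [mul_pow, h3]
    ring
  · simp [h.rep_zero, show j ≠ 0 by omega, add_comm]

theorem exists_tangentGerm {g : Diff} (hg : g ∈ tangentToId) (h1 : g ≠ 1) :
    ∃ j u, TangentGerm j g.rep u ∧ u 0 ≠ 0 := by
  have hd : AnalyticAt ℂ (fun z => g.rep z - z) 0 := g.analyticAt_rep.sub analyticAt_id
  have hne : ¬ ∀ᶠ z in 𝓝 (0 : ℂ), g.rep z - z = 0 := fun h => by
    have h' : g.rep =ᶠ[𝓝 0] fun z => z := h.mono fun z hz => sub_eq_zero.1 hz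
    exact h1 (Diff.ext_rep (h'.trans Diff.rep_one.symm))
  obtain ⟨n, u, hu, hu0, e⟩ := hd.exists_eventuallyEq_pow_smul_nonzero_iff.2 hne
  have e' : g.rep =ᶠ[𝓝 0] fun z => z + z ^ n * u z := e.mono fun z hz => by
    rw [sub_zero, smul_eq_mul] at hz
    linear_combination hz
  -- Orders $0$ and $1$ are excluded by $g(0)=0$ and $g'(0)=1$.
  rcases n with _ | _ | j
  · have := e'.eq_of_nhds
    rw [g.rep_zero] at this
    simp at this
    exact absurd this.symm hu0
  · have h1 : HasDerivAt (fun z => z + z ^ (0 + 1) * u z) _ 0 := (hasDerivAt_id' (0 : ℂ)).add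
      ((hasDerivAt_pow (0 + 1) (0 : ℂ)).mul hu.differentiableAt.hasDerivAt)
    have h2 := e'.deriv_eq.trans h1.deriv
    rw [show deriv g.rep 0 = 1 from hg] at h2
    simp at h2
    exact absurd h2 hu0
  · exact ⟨j + 1, u, ⟨by omega, hu, e'⟩, hu0⟩

theorem TangentGerm.taylorSeries_eq (h : TangentGerm j f u) :
    taylorSeries f = PowerSeries.X + PowerSeries.X ^ (j + 1) * taylorSeries u := by
  have hid : AnalyticAt ℂ (fun z : ℂ => z) 0 := analyticAt_id
  rw [taylorSeries_congr h.eventuallyEq,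
    taylorSeries_add hid ((hid.fun_pow (j + 1)).fun_mul h.analyticAt),
    taylorSeries_mul (hid.fun_pow (j + 1)) h.analyticAt, taylorSeries_pow hid, taylorSeries_id]

end Germs

/-! ### Groups of germs with a single order of contact -/

section Groups

/-- A group of germs such that the nontrivial elements tangent to the identity all have order of
contact `j + 1` with the identity. -/
def HasContactOrder (j : ℕ) (G : Subgroup Diff) : Prop :=
  ∀ g ∈ G ⊓ tangentToId, ∃ u, TangentGerm j g.rep u ∧ (u 0 = 0 → g = 1)

variable {j : ℕ} {G : Subgroup Diff}

/-- $gh$ and $hg$ have the same leading coefficient, so that of $gh(hg)^{-1}$ is zero and this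
element is trivial. -/
theorem HasContactOrder.commute (hG : HasContactOrder j G) {g h : Diff}
    (hg : g ∈ G ⊓ tangentToId) (hh : h ∈ G ⊓ tangentToId) : g * h = h * g := by
  obtain ⟨u, hu, -⟩ := hG g hg
  obtain ⟨v, hv, -⟩ := hG h hh
  obtain ⟨p, hp, hp0⟩ := hu.mul hv
  obtain ⟨q, hq, hq0⟩ := hv.mul hu
  obtain ⟨w, hw, hw1⟩ := hG (g * h * (h * g)⁻¹) (mul_mem (mul_mem hg hh) (inv_mem (mul_mem hh hg)))
  obtain ⟨s, hs, hs0⟩ := hw.mul hq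
  rw [inv_mul_cancel_right] at hs
  have := hs.eq_at_zero hp
  refine mul_inv_eq_one.1 (hw1 ?_)
  linear_combination this - hs0 + hp0 - hq0

theorem HasContactOrder.isSolvable (hG : HasContactOrder j G) : Group.IsSolvable G := by
  have hker : Group.IsSolvable (multiplier.comp G.subtype).ker := by
    refine Group.isSolvable_of_comm fun a b => ?_
    have hmem : ∀ c : (multiplier.comp G.subtype).ker, ((c : G) : Diff) ∈ G ⊓ tangentToId :=
      fun c => ⟨(c : G).2, by rw [← ker_multiplier]; exact c.2⟩
    exact Subtype.ext (Subtype.ext (hG.commute (hmem a) (hmem b)))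
  exact Group.isSolvable_of_ker_le_range (multiplier.comp G.subtype).ker.subtype
    (multiplier.comp G.subtype) (by rw [Subgroup.range_subtype])

-- Bootstrap: if $a$ has order at least $k+1$, then $\exp(\theta)(z)-z$ equals $a$ modulo $X^{k+2}$,
-- and it is divisible by $X^{j+1}$.
open PowerSeries in
theorem X_pow_dvd_of_formalExp_eq {a U : PowerSeries ℂ} (ha : X ^ 2 ∣ a) (hj : 1 ≤ j)
    (h : formalExp 1 a X = X + X ^ (j + 1) * U) : X ^ (j + 1) ∣ a := by
  suffices H : ∀ k ≤ j, 1 ≤ k → X ^ (k + 1) ∣ a from H j le_rfl hj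
  intro k
  induction k with
  | zero => omega
  | succ k ih =>
    intro hk _
    rcases Nat.eq_zero_or_pos k with rfl | hk0
    · exact ha
    have h1 := X_pow_dvd_formalExp_X_sub (by omega) (ih (by omega) hk0) 1
    have h2 : X ^ (k + 1 + 1) ∣ X ^ (j + 1) * U := (pow_dvd_pow X (by omega)).mul_right _
    have := dvd_sub h2 h1
    rw [h, one_smul] at this
    convert this using 1
    ring

open PowerSeries in
theorem HasContactOrder.exists_isExp (hG : HasContactOrder j G) :
    ∃ a : PowerSeries ℂ, X ^ 2 ∣ a ∧ ∀ g ∈ G ⊓ tangentToId, ∃ c : ℂ, IsExp c a g.taylor := by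
  by_cases htriv : ∀ g ∈ G ⊓ tangentToId, g = 1
  · refine ⟨0, dvd_zero _, fun g hg => ⟨0, ?_⟩⟩
    rw [htriv g hg, Diff.taylor_eq, taylorSeries_congr Diff.rep_one, taylorSeries_id]
    have : formalExp 0 0 X = X := by
      refine sub_eq_zero.1 (eq_zero_of_forall_X_pow_dvd fun n => ?_)
      have := X_pow_dvd_formalExp_X_sub (a := 0) (l := n + 2) (by omega) (dvd_zero _) 0
      rw [smul_zero, add_zero] at this
      exact (pow_dvd_pow X (by omega)).trans this
    simpa only [this] using isExp_formalExp (dvd_zero (X ^ 2)) 0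
  push Not at htriv
  obtain ⟨g, hg, hg1⟩ := htriv
  obtain ⟨u, hu, hu1⟩ := hG g hg
  have hu0 : u 0 ≠ 0 := fun h => hg1 (hu1 h)
  have hj := hu.pos
  have hX2 : ∀ {f w : ℂ → ℂ}, TangentGerm j f w → X ^ 2 ∣ taylorSeries f - X := fun h => by
    rw [h.taylorSeries_eq, add_sub_cancel_left]
    exact (pow_dvd_pow X (by omega)).mul_right _
  obtain ⟨a, ha, hexp⟩ := exists_formalExp_eq (hX2 hu)
  refine ⟨a, ha, fun h hh => ?_⟩
  obtain ⟨v, hv, -⟩ := hG h hh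
  refine ⟨v 0 / u 0, ?_⟩
  set c := v 0 / u 0
  have hexp' : formalExp 1 a X = X + X ^ (j + 1) * taylorSeries u := hexp.trans hu.taylorSeries_eq
  have haj := X_pow_dvd_of_formalExp_eq ha hj hexp'
  have hsX : substAlgHom (R := ℂ) (hasSubst_taylorSeries h.rep_zero) X = taylorSeries h.rep :=
    substAlgHom_X _
  -- Identifying $\exp\theta$ with substitution of $g$ turns commutation in $G$ into commutation of
  -- algebra endomorphisms.
  have hρ : formalExpHom 1 ha = substAlgHom (R := ℂ) (hasSubst_taylorSeries g.rep_zero) := by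
    refine algHom_ext_X (X_dvd_iff.2 ?_) ?_
    · rw [substAlgHom_X, constantCoeff_taylorSeries, g.rep_zero]
    · rw [substAlgHom_X, formalExpHom_apply, hexp]
  have key : taylorSeries h.rep = formalExp c a X := by
    rw [← hsX, ← formalExpHom_apply c ha]
    refine eq_of_commute_of_dvd_sub (ρ := formalExpHom 1 ha) (l := j + 1) (u := taylorSeries u)
      (by omega) (by rwa [constantCoeff_taylorSeries]) hexp' ?_ ?_ ?_ ?_ ?_
    · rw [hsX]; exact hX2 hv
    · have h1 := X_pow_dvd_formalExp_X_sub le_rfl ha c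
      have h2 : X ^ 2 ∣ c • a := by rw [smul_eq_C_mul]; exact ha.mul_left _
      have := dvd_add ((pow_dvd_pow X (by omega : 2 ≤ 2 + 1)).trans h1) h2
      rw [formalExpHom_apply]
      convert this using 1
      ring
    · rw [hsX, formalExpHom_apply 1 ha X, hexp, hρ,
        ← taylorSeries_comp h.analyticAt_rep g.analyticAt_rep g.rep_zero,
        ← taylorSeries_comp g.analyticAt_rep h.analyticAt_rep h.rep_zero]
      refine taylorSeries_congr ((Diff.rep_mul h g).symm.trans ?_)
      rw [hG.commute hh hg]
      exact Diff.rep_mul g h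
    · exact formalExp_comm ha 1 c X
    -- The choice of `c` enters here: the coefficients of degree $j+1$ of $h$ and $\exp(c\theta)(z)$
    -- are $v(0)$ and $c\,u(0)$.
    · have h1 := X_pow_dvd_formalExp_X_sub (by omega) haj c
      have h2 := X_pow_dvd_formalExp_X_sub (by omega) haj 1
      rw [hexp', one_smul] at h2
      have h3 : X ^ (j + 1 + 1) ∣ X ^ (j + 1) * (taylorSeries v - C c * taylorSeries u) := by
        rw [pow_succ]
        refine mul_dvd_mul_left _ (X_dvd_iff.2 ?_)
        rw [map_sub, map_mul, constantCoeff_C, constantCoeff_taylorSeries,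
          constantCoeff_taylorSeries, div_mul_cancel₀ _ hu0, sub_self]
      have := dvd_sub (dvd_add h3 (h2.mul_left (C c))) h1
      rw [hsX, formalExpHom_apply, hv.taylorSeries_eq]
      rw [smul_eq_C_mul] at this
      convert this using 1
      ring
  rw [Diff.taylor_eq, key]
  exact isExp_formalExp ha c

theorem exists_hasContactOrder {r : ℝ} (hr : 0 < r) {D : DGroupoid r} (hD : ¬ autDisc r ⊆ D.sol)
    (hG : D.Admits G) : ∃ j, HasContactOrder j G := by
  by_cases htriv : ∀ g ∈ G ⊓ tangentToId, g = 1
  · refine ⟨1, fun g hg => ⟨0, ?_, fun _ => htriv g hg⟩⟩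
    rw [htriv g hg]
    exact tangentGerm_one le_rfl
  push Not at htriv
  obtain ⟨g, hg, hg1⟩ := htriv
  obtain ⟨j, u, hu, hu0⟩ := exists_tangentGerm hg.2 hg1
  refine ⟨j, fun h hh => ?_⟩
  by_cases hh1 : h = 1
  · subst hh1
    exact ⟨0, tangentGerm_one hu.pos, fun _ => rfl⟩
  obtain ⟨i, v, hv, hv0⟩ := exists_tangentGerm hh.2 hh1
  obtain rfl := DGroupoid.contact_order_unique hr hD hu hv hu0 hv0 (hG g hg.1).2 (hG h hh.1).2
  exact ⟨v, hv, fun h0 => absurd h0 hv0⟩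

/-- The closure is an intersection inside $\mathrm{Aut}(\Delta)$, $G_\infty$ being one of its
members, so if it is proper some member already is. -/
theorem HasProperGaloisClosure.exists_admits {r : ℝ} (hr : 0 < r)
    (hG : HasProperGaloisClosure r G) :
    ∃ D : DGroupoid r, D.Admits G ∧ ¬ autDisc r ⊆ D.sol := by
  by_contra! hall
  refine hG (Set.Subset.antisymm (fun p hp => (hp .infinite fun g _ => ?_).1)
    fun p hp D hD => hall D hD hp)
  refine ⟨⟨Metric.mem_ball_self hr, g.analyticAt_rep, ?_, g.deriv_rep_ne_zero⟩,
    Eventually.of_forall fun _ => rfl⟩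
  simpa [g.rep_zero] using hr

end Groups

end GaloisClosure

end

theorem proposition1p7 (r : ℝ) (hr : 0 < r) (G : Subgroup GaloisClosure.Diff)
    (hG : GaloisClosure.HasProperGaloisClosure r G) :
    Group.IsSolvable G ∧
    (∀ g ∈ G ⊓ GaloisClosure.tangentToId, ∀ h ∈ G ⊓ GaloisClosure.tangentToId,
      g * h = h * g) ∧
    ∃ a : PowerSeries ℂ, PowerSeries.X ^ 2 ∣ a ∧
      ∀ g ∈ G ⊓ GaloisClosure.tangentToId, ∃ c : ℂ, GaloisClosure.IsExp c a g.taylor := by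
  obtain ⟨D, hDG, hD⟩ := hG.exists_admits hr
  obtain ⟨j, hj⟩ := GaloisClosure.exists_hasContactOrder hr hD hDG
  exact ⟨hj.isSolvable, fun g hg h hh => hj.commute hg hh, hj.exists_isExp⟩
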